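/- Let $K$ be a number field with ring of integers $\mathcal{O}_K$ and class group $\mathrm{Cl}(K)$, let $\mathfrak{n}$ be a nonzero ideal of $\mathcal{O}_K$, and put $\widehat K=K\otimes_{\mathbb{Q}}\mathbb{R}$ and $\mathcal{G}=\mathrm{GL}(2,\widehat K)$, acting on the row space $\widehat K^2$ by multiplication on the right. An $\mathcal{O}_K$-lattice is a finitely generated $\mathcal{O}_K$-submodule $L\subset\widehat K^2$ with $\widehat K L=\widehat K^2$ and $\dim_K(KL)=2$ (equivalently, $\widehat KL=\widehat K^2$ and $F_1\subseteq L\subseteq F_2$ for some free $\mathcal{O}_K$-submodules $F_1,F_2$ of rank $2$). Its class is the ideal class of $\mathfrak{a}$, where $L\cong\mathcal{O}_K\oplus\mathfrak{a}$. A modular point for $\Gamma_0(\mathfrak{n})$ is a pair $(L,L')$ of lattices with $L\subseteq L'$ and $L'/L\cong\mathcal{O}_K/\mathfrak{n}$. A modular point for $\Gamma_1(\mathfrak{n})$ is a triple $(L,L',\beta)$, where $(L,L')$ is a modular point for $\Gamma_0(\mathfrak{n})$ (the underlying one) and $\beta\in L'$ satisfies $L'=L+\mathcal{O}_K\beta$;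 the triples $(L,L',\beta_1)$ and $(L,L',\beta_2)$ are identified when $\beta_1-\beta_2\in L$. The class of such a point is the class of $L$. Let $\mathcal{M}_1(\mathfrak{n})$ be the set of modular points for $\Gamma_1(\mathfrak{n})$ and $\mathcal{M}_1^{(c)}(\mathfrak{n})$ the subset of those of class $c$. The group $\mathcal{G}$ acts on the right by $(L,L',\beta)U=(LU,L'U,\beta U)$. Fix the following choices. Let $\mathfrak{p}_i$ $(1\le i\le h_2)$ be nonzero ideals of $\mathcal{O}_K$ whose classes represent the cosets in $\mathrm{Cl}(K)/\mathrm{Cl}(K)^2$, each exactly once, and let $\mathfrak{q}_j$ $(1\le j\le h_2')$ be nonzero ideals such that the $[\mathfrak{q}_j]^2$ run through $\mathrm{Cl}(K)^2$, each element exactly once, with $\mathfrak{p}_1=\mathfrak{q}_1=\mathcal{O}_K$; here $h_2=[\mathrm{Cl}(K):\mathrm{Cl}(K)^2]$ and $h_2'=\#\mathrm{Cl}(K)^2$. Put $c_{ij}=[\mathfrak{p}_i][\mathfrak{q}_j]^2$. Let $n_0\in\mathfrak{n}^{-1}$ be such that $\mathfrak{n}^{-1}=\mathcal{O}_K+n_0\mathcal{O}_K$.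 For each $j$ let $\mathfrak{a}_j$ be an ideal of $\mathcal{O}_K$ coprime to $\mathfrak{n}$ and $z_j\in\mathcal{O}_K$ with $\mathfrak{a}_j\mathfrak{q}_j=z_j\mathcal{O}_K$. The standard modular points are $$\widetilde P_{ij}=\bigl(\mathfrak{p}_i\mathfrak{q}_j\oplus\mathfrak{q}_j,\ \mathfrak{p}_i\mathfrak{q}_j\oplus\mathfrak{q}_j\mathfrak{n}^{-1},\ (0,n_0z_j)\bigr).$$ An admissible basis matrix for $\widetilde P\in\mathcal{M}_1^{(c_{ij})}(\mathfrak{n})$ is a matrix $U\in\mathcal{G}$ with $\widetilde P=\widetilde P_{ij}U$. Finally, for a nonzero ideal $\mathfrak{p}$ let $$\Gamma_0^{\mathfrak{p}}(\mathfrak{n})=\left\{\begin{pmatrix}a&b\\c&d\end{pmatrix}\in\mathrm{GL}(2,K)\ :\ a,d\in\mathcal{O}_K,\ b\in\mathfrak{p}^{-1},\ c\in\mathfrak{n}\mathfrak{p},\ ad-bc\in\mathcal{O}_K^\times\right\},$$ $$\Gamma_1^{\mathfrak{p}}(\mathfrak{n})=\left\{\begin{pmatrix}a&b\\c&d\end{pmatrix}\in\Gamma_0^{\mathfrak{p}}(\mathfrak{n})\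 :\ d-1\in\mathfrak{n}\right\},$$ regarded as subgroups of $\mathcal{G}$ through $K\hookrightarrow\widehat K$. **Proposition.** Every modular point $\widetilde P$ for $\Gamma_1(\mathfrak{n})$ has class $c_{ij}$ for exactly one pair $(i,j)$, and has an admissible basis matrix. If $\widetilde P$ has class $c_{ij}$ and $U$ is any admissible basis matrix for $\widetilde P$, then 1. the set of all admissible basis matrices for $\widetilde P$ is the coset $\Gamma_1^{\mathfrak{p}_i}(\mathfrak{n})U$; 2. the set of modular points for $\Gamma_1(\mathfrak{n})$ with the same underlying modular point for $\Gamma_0(\mathfrak{n})$ as $\widetilde P$ is $\{\widetilde P\,U^{-1}\gamma U\mid\gamma\in\Gamma_0^{\mathfrak{p}_i}(\mathfrak{n})\}$. Hence, for all $i,j$, $$\mathcal{M}_1^{(c_{ij})}(\mathfrak{n})=\{\widetilde P_{ij}U\mid U\in\mathcal{G}\},$$ and $\widetilde P_{ij}U\leftrightarrow U$ is a well-defined bijection $\mathcal{M}_1^{(c_{ij})}(\mathfrak{n})\longleftrightarrow\Gamma_1^{\mathfrak{p}_i}(\mathfrak{n})\backslash\mathcal{G}$. -/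

import Mathlib

open scoped TensorProduct NumberField nonZeroDivisors

noncomputable section

namespace ModularPoints

variable (K : Type*) [Field K] [NumberField K]

/-- The real algebra `K ⊗ ℝ` (over `ℚ`), with `K` embedded by `x ↦ x ⊗ 1`. -/
abbrev KHat : Type _ := K ⊗[ℚ] ℝ

/-- Row vectors of length two over `KHat K`. -/
abbrev RowSpace : Type _ := Fin 2 → KHat K

/-- The group `GL(2, KHat K)`; it acts on row vectors by multiplication on the right. -/
abbrev GG : Type _ := GL (Fin 2) (KHat K)

variable {K}

/-- Right multiplication `v ↦ v U`, as a map of `𝓞 K`-modules. -/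
def rightMul (U : GG K) : RowSpace K →ₗ[𝓞 K] RowSpace K :=
  (Matrix.vecMulLinear (U : Matrix (Fin 2) (Fin 2) (KHat K))).restrictScalars (𝓞 K)

/-- `𝓞 K`-lattices in the row space. -/
structure IsOKLattice (L : Submodule (𝓞 K) (RowSpace K)) : Prop where
  span_eq_top : Submodule.span (KHat K) (L : Set (RowSpace K)) = ⊤
  between_free : ∃ F₁ F₂ : Submodule (𝓞 K) (RowSpace K),
    Module.Free (𝓞 K) F₁ ∧ Module.finrank (𝓞 K) F₁ = 2 ∧
    Module.Free (𝓞 K) F₂ ∧ Module.finrank (𝓞 K) F₂ = 2 ∧ F₁ ≤ L ∧ L ≤ F₂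
  fg : L.FG
  finrank_span : Module.finrank K (Submodule.span K (L : Set (RowSpace K))) = 2

/-- `L` has Steinitz class `c`: it is isomorphic to `𝓞 K ⊕ 𝔞` with `𝔞` in the class `c`. -/
def HasClass (L : Submodule (𝓞 K) (RowSpace K)) (c : ClassGroup (𝓞 K)) : Prop :=
  ∃ a : (Ideal (𝓞 K))⁰, ClassGroup.mk0 a = c ∧
    Nonempty (L ≃ₗ[𝓞 K] (𝓞 K × (a : Ideal (𝓞 K))))

/-- Modular points for `Γ₀(n)`: pairs of lattices `L ⊆ L'` with `L' / L ≅ 𝓞 K / n`. -/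
structure IsModularPoint₀ (n : (Ideal (𝓞 K))⁰)
    (L L' : Submodule (𝓞 K) (RowSpace K)) : Prop where
  lattice : IsOKLattice L
  lattice' : IsOKLattice L'
  le : L ≤ L'
  quot : Nonempty ((L' ⧸ L.submoduleOf L') ≃ₗ[𝓞 K] (𝓞 K ⧸ (n : Ideal (𝓞 K))))

variable (K) in
/-- Triples `(L, L', β)` of two submodules and a vector, with no condition imposed. -/
structure RawTriple where
  L : Submodule (𝓞 K) (RowSpace K)
  L' : Submodule (𝓞 K) (RowSpace K)
  β : RowSpace K

variable (K) in
/-- Triples `(L, L', β₁)` and `(L, L', β₂)` are identified when `β₁ - β₂ ∈ L`. -/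
instance rawTripleSetoid : Setoid (RawTriple K) where
  r s t := s.L = t.L ∧ s.L' = t.L' ∧ s.β - t.β ∈ s.L
  iseqv :=
    { refl := fun s => ⟨rfl, rfl, by simp⟩
      symm := fun {s t} h => ⟨h.1.symm, h.2.1.symm, by
        rw [← h.1, ← neg_sub]; exact s.L.neg_mem h.2.2⟩
      trans := fun {s t u} h k => ⟨h.1.trans k.1, h.2.1.trans k.2.1, by
        have h2 := k.2.2
        rw [← h.1] at h2
        simpa using s.L.add_mem h.2.2 h2⟩ }

variable (K) in
/-- Triples `(L, L', β)` up to changing `β` by an element of `L`. -/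
abbrev Triple : Type _ := Quotient (rawTripleSetoid K)

/-- The class of the triple `(L, L', β)`. -/
def mkTriple (L L' : Submodule (𝓞 K) (RowSpace K)) (β : RowSpace K) : Triple K :=
  Quotient.mk _ ⟨L, L', β⟩

/-- The right action `(L, L', β) U = (L U, L' U, β U)`. -/
def Triple.act (P : Triple K) (U : GG K) : Triple K :=
  Quotient.map
    (fun t : RawTriple K =>
      (⟨t.L.map (rightMul U), t.L'.map (rightMul U), rightMul U t.β⟩ : RawTriple K))
    (fun s t (h : s.L = t.L ∧ s.L' = t.L' ∧ s.β - t.β ∈ s.L) =>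
      ⟨congrArg (Submodule.map (rightMul U)) h.1, congrArg (Submodule.map (rightMul U)) h.2.1, by
        rw [← map_sub]; exact Submodule.mem_map_of_mem h.2.2⟩) P

/-- The underlying pair `(L, L')`. -/
def Triple.pair (P : Triple K) :
    Submodule (𝓞 K) (RowSpace K) × Submodule (𝓞 K) (RowSpace K) :=
  Quotient.lift (fun t : RawTriple K => (t.L, t.L'))
    (fun s t (h : s.L = t.L ∧ s.L' = t.L' ∧ s.β - t.β ∈ s.L) => Prod.ext h.1 h.2.1) P

/-- The set of modular points for `Γ₁(n)`: `(L, L')` is a modular point for `Γ₀(n)` and `β ∈ L'`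
satisfies `L' = L + (𝓞 K) β`. -/
def M₁ (n : (Ideal (𝓞 K))⁰) : Set (Triple K) :=
  {P | ∃ (L L' : Submodule (𝓞 K) (RowSpace K)) (β : RowSpace K),
    IsModularPoint₀ n L L' ∧ β ∈ L' ∧ L' = L ⊔ Submodule.span (𝓞 K) {β} ∧ P = mkTriple L L' β}

/-- The modular points for `Γ₁(n)` whose underlying lattice has class `c`. -/
def M₁Class (n : (Ideal (𝓞 K))⁰) (c : ClassGroup (𝓞 K)) : Set (Triple K) :=
  {P | P ∈ M₁ n ∧ HasClass P.pair.1 c}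

/-- A nonzero integral ideal as a fractional ideal. -/
abbrev frac (a : (Ideal (𝓞 K))⁰) : FractionalIdeal (𝓞 K)⁰ K := ((a : Ideal (𝓞 K)) : _)

/-- The submodule `𝔞 ⊕ 𝔟` of the row space, for fractional ideals `𝔞`, `𝔟` of `K`. -/
def oplus (a b : FractionalIdeal (𝓞 K)⁰ K) : Submodule (𝓞 K) (RowSpace K) where
  carrier := {v | ∃ x ∈ a, ∃ y ∈ b, v = ![algebraMap K (KHat K) x, algebraMap K (KHat K) y]}
  zero_mem' := ⟨0, a.zero_mem, 0, b.zero_mem, by ext i; fin_cases i <;> simp⟩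
  add_mem' := by
    rintro _ _ ⟨x, hx, y, hy, rfl⟩ ⟨x', hx', y', hy', rfl⟩
    exact ⟨x + x', (a : Submodule (𝓞 K) K).add_mem hx hx', y + y',
      (b : Submodule (𝓞 K) K).add_mem hy hy', by
        ext i; fin_cases i <;> simp [TensorProduct.add_tmul]⟩
  smul_mem' := by
    rintro r _ ⟨x, hx, y, hy, rfl⟩
    refine ⟨r • x, (a : Submodule (𝓞 K) K).smul_mem r hx, r • y,
      (b : Submodule (𝓞 K) K).smul_mem r hy, ?_⟩
    ext i
    fin_cases i <;> simp [Algebra.TensorProduct.algebraMap_apply, TensorProduct.smul_tmul']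

variable (K) in
/-- The subgroup of squares in the class group. -/
abbrev squares : Subgroup (ClassGroup (𝓞 K)) := (powMonoidHom 2).range

/-- The choices, fixed once and for all, of standard ideals and of generators:
`p i` represent the classes modulo squares, the `[q j]²` run through the squares,
`n₀` generates `n⁻¹` modulo `𝓞 K`, and `a j` is coprime to `n` with `(a j) (q j) = (z j)`. -/
structure Choices (n : (Ideal (𝓞 K))⁰) where
  p : Fin (squares K).index → (Ideal (𝓞 K))⁰
  q : Fin (Nat.card (squares K)) → (Ideal (𝓞 K))⁰
  p_first : ∀ i, i.val = 0 → p i = 1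
  q_first : ∀ j, j.val = 0 → q j = 1
  p_bijective : Function.Bijective
    (fun i => (QuotientGroup.mk (ClassGroup.mk0 (p i)) : ClassGroup (𝓞 K) ⧸ squares K))
  q_bijOn : Set.BijOn (fun j => ClassGroup.mk0 (q j) ^ 2) Set.univ (squares K)
  n₀ : K
  n₀_gen : (frac n)⁻¹ =
    FractionalIdeal.spanSingleton (𝓞 K)⁰ 1 + FractionalIdeal.spanSingleton (𝓞 K)⁰ n₀
  a : Fin (Nat.card (squares K)) → (Ideal (𝓞 K))⁰
  z : Fin (Nat.card (squares K)) → 𝓞 K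
  a_coprime : ∀ j, IsCoprime (a j : Ideal (𝓞 K)) (n : Ideal (𝓞 K))
  a_mul_q : ∀ j, (a j : Ideal (𝓞 K)) * (q j : Ideal (𝓞 K)) = Ideal.span {z j}

namespace Choices

variable {n : (Ideal (𝓞 K))⁰} (D : Choices n)

/-- The ideal class `c_ij = [p_i] [q_j]²`. -/
def c (i : Fin (squares K).index) (j : Fin (Nat.card (squares K))) : ClassGroup (𝓞 K) :=
  ClassGroup.mk0 (D.p i) * ClassGroup.mk0 (D.q j) ^ 2

/-- The standard modular point
`(p_i q_j ⊕ q_j, p_i q_j ⊕ q_j n⁻¹, (0, n₀ z_j))` for `Γ₁(n)`. -/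
def stdPoint (i : Fin (squares K).index) (j : Fin (Nat.card (squares K))) : Triple K :=
  mkTriple (oplus (frac (D.p i) * frac (D.q j)) (frac (D.q j)))
    (oplus (frac (D.p i) * frac (D.q j)) (frac (D.q j) * (frac n)⁻¹))
    ![0, algebraMap K (KHat K) (D.n₀ * (D.z j : K))]

/-- `U` is an admissible basis matrix for the modular point `P`: if `c_ij` is the class of `P`
then `P` is the image of the standard modular point under `U`. -/
def IsAdmissible (P : Triple K) (U : GG K) : Prop :=
  ∃ i j, P ∈ M₁Class n (D.c i j) ∧ P = (D.stdPoint i j).act U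

end Choices

set_option linter.unusedSectionVars false

theorem frac_add {I : FractionalIdeal (𝓞 K)⁰ K} {x y : K} (hx : x ∈ I) (hy : y ∈ I) :
    x + y ∈ I := (I : Submodule (𝓞 K) K).add_mem hx hy

theorem frac_neg {I : FractionalIdeal (𝓞 K)⁰ K} {x : K} (hx : x ∈ I) : -x ∈ I :=
  (I : Submodule (𝓞 K) K).neg_mem hx

theorem frac_one_mul {I : FractionalIdeal (𝓞 K)⁰ K} {x y : K}
    (hx : x ∈ (1 : FractionalIdeal (𝓞 K)⁰ K)) (hy : y ∈ I) : x * y ∈ I := by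
  simpa using FractionalIdeal.mul_mem_mul hx hy

theorem frac_mul_one {I : FractionalIdeal (𝓞 K)⁰ K} {x y : K}
    (hx : x ∈ I) (hy : y ∈ (1 : FractionalIdeal (𝓞 K)⁰ K)) : x * y ∈ I := by
  simpa using FractionalIdeal.mul_mem_mul hx hy

theorem coe_mem_one (x : 𝓞 K) : (x : K) ∈ (1 : FractionalIdeal (𝓞 K)⁰ K) :=
  (FractionalIdeal.mem_one_iff _).2 ⟨x, rfl⟩

theorem level_le_one (n : (Ideal (𝓞 K))⁰) {x : K} (hx : x ∈ frac n) :
    x ∈ (1 : FractionalIdeal (𝓞 K)⁰ K) :=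
  FractionalIdeal.coeIdeal_le_one hx

theorem inv_mul_mem {n p : (Ideal (𝓞 K))⁰} {x y : K}
    (hx : x ∈ (frac p)⁻¹) (hy : y ∈ frac n * frac p) : x * y ∈ frac n := by
  have hp : frac p ≠ 0 := FractionalIdeal.coeIdeal_ne_zero.2 (nonZeroDivisors.coe_ne_zero p)
  have h := FractionalIdeal.mul_mem_mul hx hy
  rwa [mul_comm (frac n), ← mul_assoc, inv_mul_cancel₀ hp, one_mul] at h

theorem inv_entries (g : GL (Fin 2) K) (u : (𝓞 K)ˣ)
    (hu : (g : Matrix (Fin 2) (Fin 2) K).det = ((u : 𝓞 K) : K)) :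
    g⁻¹ 0 0 = (((u⁻¹ : (𝓞 K)ˣ) : 𝓞 K) : K) * g 1 1 ∧
    g⁻¹ 0 1 = (((u⁻¹ : (𝓞 K)ˣ) : 𝓞 K) : K) * -g 0 1 ∧
    g⁻¹ 1 0 = (((u⁻¹ : (𝓞 K)ˣ) : 𝓞 K) : K) * -g 1 0 ∧
    g⁻¹ 1 1 = (((u⁻¹ : (𝓞 K)ˣ) : 𝓞 K) : K) * g 0 0 ∧
    ((g⁻¹ : GL (Fin 2) K) : Matrix (Fin 2) (Fin 2) K).det =
      (((u⁻¹ : (𝓞 K)ˣ) : 𝓞 K) : K) := by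
  have h1 : (((u⁻¹ : (𝓞 K)ˣ) : 𝓞 K) : K) * ((u : 𝓞 K) : K) = 1 := by
    rw [← map_mul, Units.inv_mul, map_one]
  have h2 : (((u : 𝓞 K) : K))⁻¹ = (((u⁻¹ : (𝓞 K)ˣ) : 𝓞 K) : K) :=
    (eq_inv_of_mul_eq_one_left h1).symm
  have h3 : ((g : Matrix (Fin 2) (Fin 2) K)⁻¹).det = (((u⁻¹ : (𝓞 K)ˣ) : 𝓞 K) : K) := by
    rw [Matrix.det_nonsing_inv, hu, Ring.inverse_eq_inv', h2]
  have h4 : (g : Matrix (Fin 2) (Fin 2) K)⁻¹ = (((u⁻¹ : (𝓞 K)ˣ) : 𝓞 K) : K) •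
      !![g 1 1, -g 0 1; -g 1 0, g 0 0] := by
    rw [Matrix.inv_def, hu, Ring.inverse_eq_inv', h2, Matrix.adjugate_fin_two]
  rw [Matrix.coe_units_inv]
  refine ⟨?_, ?_, ?_, ?_, h3⟩ <;> rw [h4] <;> rfl

/-- The group of matrices in `GL(2, K)` with `(1,1)` and `(2,2)` entries in `𝓞 K`, with
`(1,2)` entry in `p⁻¹`, with `(2,1)` entry in `n p`, and with determinant a unit of `𝓞 K`. -/
def gamma₀ (n p : (Ideal (𝓞 K))⁰) : Subgroup (GL (Fin 2) K) where
  carrier := {g | g 0 0 ∈ (1 : FractionalIdeal (𝓞 K)⁰ K) ∧ g 0 1 ∈ (frac p)⁻¹ ∧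
    g 1 0 ∈ frac n * frac p ∧ g 1 1 ∈ (1 : FractionalIdeal (𝓞 K)⁰ K) ∧
    ∃ u : (𝓞 K)ˣ, (g : Matrix (Fin 2) (Fin 2) K).det = ((u : 𝓞 K) : K)}
  one_mem' := by
    refine ⟨?_, ?_, ?_, ?_, 1, by simp⟩
    · simp
    · exact (frac p)⁻¹.zero_mem
    · exact (frac n * frac p).zero_mem
    · simp
  mul_mem' := by
    rintro g h ⟨ga, gb, gc, gd, u, hu⟩ ⟨ha, hb, hc, hd, v, hv⟩
    simp only [Set.mem_ofPred_eq, Units.val_mul, Matrix.mul_apply, Fin.sum_univ_two]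
    refine ⟨?_, ?_, ?_, ?_, u * v, by simp [Matrix.det_mul, hu, hv]⟩
    · exact frac_add (frac_one_mul ga ha) (level_le_one n (inv_mul_mem gb hc))
    · exact frac_add (frac_one_mul ga hb) (frac_mul_one gb hd)
    · exact frac_add (frac_mul_one gc ha) (frac_one_mul gd hc)
    · refine frac_add (level_le_one n ?_) (frac_one_mul gd hd)
      rw [mul_comm]
      exact inv_mul_mem hb gc
  inv_mem' := by
    rintro g ⟨ga, gb, gc, gd, u, hu⟩
    obtain ⟨e1, e2, e3, e4, e5⟩ := inv_entries g u hu
    simp only [Set.mem_ofPred_eq, e1, e2, e3, e4]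
    exact ⟨frac_one_mul (coe_mem_one _) gd, frac_one_mul (coe_mem_one _) (frac_neg gb),
      frac_one_mul (coe_mem_one _) (frac_neg gc), frac_one_mul (coe_mem_one _) ga, u⁻¹, e5⟩

/-- The matrices in `gamma₀ n p` whose `(2,2)` entry is congruent to `1` modulo `n`. -/
def gamma₁ (n p : (Ideal (𝓞 K))⁰) : Subgroup (GL (Fin 2) K) where
  carrier := {g | g ∈ gamma₀ n p ∧ g 1 1 - 1 ∈ frac n}
  one_mem' := ⟨one_mem _, by simp⟩
  mul_mem' := by
    rintro g h ⟨hg, g1⟩ ⟨hh, h1⟩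
    refine ⟨mul_mem hg hh, ?_⟩
    obtain ⟨ga, gb, gc, gd, u, hu⟩ := hg
    obtain ⟨ha, hb, hc, hd, v, hv⟩ := hh
    have e : (g * h) 1 1 - 1 = h 0 1 * g 1 0 + (g 1 1 * (h 1 1 - 1) + (g 1 1 - 1)) := by
      simp only [Units.val_mul, Matrix.mul_apply, Fin.sum_univ_two]
      ring
    rw [e]
    exact frac_add (inv_mul_mem hb gc) (frac_add (frac_one_mul gd h1) g1)
  inv_mem' := by
    rintro g ⟨hg, g1⟩
    refine ⟨inv_mem hg, ?_⟩
    obtain ⟨ga, gb, gc, gd, u, hu⟩ := hg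
    obtain ⟨e1, e2, e3, e4, e5⟩ := inv_entries g u hu
    have hu' := hu
    rw [Matrix.det_fin_two] at hu'
    have h1 : (((u⁻¹ : (𝓞 K)ˣ) : 𝓞 K) : K) * ((u : 𝓞 K) : K) = 1 := by
      rw [← map_mul, Units.inv_mul, map_one]
    have e : g⁻¹ 1 1 - 1 = (((u⁻¹ : (𝓞 K)ˣ) : 𝓞 K) : K) *
        (g 0 0 * (-(g 1 1 - 1)) + g 0 1 * g 1 0) := by
      rw [e4]
      linear_combination h1 + (((u⁻¹ : (𝓞 K)ˣ) : 𝓞 K) : K) * hu'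
    rw [e]
    exact frac_one_mul (coe_mem_one _)
      (frac_add (frac_one_mul ga (frac_neg g1)) (inv_mul_mem gb gc))

/-- The inclusion of `GL(2, K)` in `GL(2, KHat K)`. -/
abbrev toGG : GL (Fin 2) K →* GG K := Matrix.GeneralLinearGroup.map (algebraMap K (KHat K))

end ModularPoints

end

open ModularPoints

noncomputable section

namespace ModularPoints

open FractionalIdeal

/-! ### Unimodular columns over a Dedekind domain. -/

section Dedekind

set_option linter.unusedSectionVars false

variable {R F : Type*} [CommRing R] [IsDedekindDomain R] [Field F] [Algebra R F]
  [IsFractionRing R F]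

/-! The proposition is orbit-stabilizer for the right action of `GG K`, given two facts: the action
is transitive on the points of a fixed class, and the stabilizers of a standard point and of its
underlying pair are `gamma₁` and `gamma₀`.

Transitivity (`exists_eq_act`). A `K`-basis of `K L` taken from `L` moves `L` into `K²`. There the
projection to a coordinate splits, its image being an invertible ideal, so `L` becomes `A ⊕ B`
(`IsOKLattice.exists_eq_map_oplus`). The class of `A B` is the Steinitz class
(`hasClass_oplus_iff`), so after scaling `A B = C D` with `C = p_i q_j` and `D = q_j`. Now `β` is a
vector `(x, y)` whose annihilator modulo `A ⊕ B` is `n`, and it must be sent to `(0, w)` with `w =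
n₀ z_j`, modulo `C ⊕ D` (`exists_map_oplus_eq_and_vec`). A column `(u, v)` with `u A + v B = D`
completes to a matrix of determinant one taking `A ⊕ B` to `C ⊕ D`. The annihilator condition gives
`(u, v)` with `x u + y v` congruent to `w` modulo `D` and `u A + v B + D n = D`. A correction of
`(u, v)` modulo `n` (`exists_unimodular`) makes the column unimodular and keeps the congruence; a
shear then clears the first coordinate.

Stabilizers. A matrix preserving `C ⊕ D` has entries in `K`, and preserving both lattices amounts to
ideal conditions on the entries and a unit determinant; `q_j` cancels. Fixing `β` modulo `L` adds
that the lower right entry is `1` modulo `n`. -/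

theorem add_le_iff {I J L : FractionalIdeal R⁰ F} : I + J ≤ L ↔ I ≤ L ∧ J ≤ L := by
  rw [← sup_eq_add, sup_le_iff]

theorem mem_add_iff {I J : FractionalIdeal R⁰ F} {x : F} :
    x ∈ I + J ↔ ∃ y ∈ I, ∃ z ∈ J, y + z = x := by
  rw [← mem_coe, coe_add]
  exact Submodule.mem_sup

theorem sub_mem_fractionalIdeal {I : FractionalIdeal R⁰ F} {x y : F} (hx : x ∈ I) (hy : y ∈ I) :
    x - y ∈ I :=
  (I : Submodule R F).sub_mem hx hy

/-- A fractional ideal `I ≤ M` that lies in no `M 𝔭` with `𝔭` maximal is equal to `M`. -/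
theorem eq_of_forall_maximal {I M : FractionalIdeal R⁰ F} (hM : M ≠ 0) (hIM : I ≤ M)
    (h : ∀ P : Ideal R, P.IsMaximal → ¬ I ≤ M * (P : FractionalIdeal R⁰ F)) : I = M := by
  have h1 : M⁻¹ * I ≤ 1 := by
    calc M⁻¹ * I ≤ M⁻¹ * M := by gcongr
      _ = 1 := inv_mul_cancel₀ hM
  obtain ⟨J, hJ⟩ := le_one_iff_exists_coeIdeal.1 h1
  have hI : I = M * (J : FractionalIdeal R⁰ F) := by
    rw [hJ, mul_inv_cancel_left₀ hM]
  by_cases hJ' : J = ⊤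
  · rw [hI, hJ', coeIdeal_top, mul_one]
  · obtain ⟨P, hP, hJP⟩ := Ideal.exists_le_maximal J hJ'
    refine absurd ?_ (h P hP)
    rw [hI]
    exact mul_le_mul_right ((coeIdeal_le_coeIdeal F).2 hJP) M

theorem mul_coeIdeal_le_mul_coeIdeal {M : FractionalIdeal R⁰ F} (hM : M ≠ 0) {I J : Ideal R} :
    M * (I : FractionalIdeal R⁰ F) ≤ M * (J : FractionalIdeal R⁰ F) ↔ I ≤ J := by
  rw [← coeIdeal_le_coeIdeal F]
  refine ⟨fun h => ?_, fun h => by gcongr⟩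
  have := mul_le_mul_right h M⁻¹
  simpa [inv_mul_cancel_left₀ hM] using this

theorem mul_coeIdeal_le (M : FractionalIdeal R⁰ F) (I : Ideal R) :
    M * (I : FractionalIdeal R⁰ F) ≤ M := by
  calc M * (I : FractionalIdeal R⁰ F) ≤ M * 1 := by gcongr; exact coeIdeal_le_one
    _ = M := mul_one M

/-- For a nonzero ideal `T` and any condition on ideals, some nonzero ideal is contained in
exactly those maximal ideals `P ≥ T` that satisfy the condition. -/
theorem exists_ideal_le_iff {T : Ideal R} (hT : T ≠ 0) (p : Ideal R → Prop) :
    ∃ D : Ideal R, D ≠ 0 ∧ ∀ P : Ideal R, P.IsMaximal → T ≤ P → (D ≤ P ↔ p P) := by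
  classical
  refine ⟨∏ v ∈ (Ideal.finite_factors hT).toFinset.filter (fun v => p v.asIdeal), v.asIdeal,
    Finset.prod_ne_zero_iff.2 fun v _ => v.ne_bot, fun P hP hTP => ⟨fun h => ?_, fun h => ?_⟩⟩
  · obtain ⟨w, hw, hwP⟩ := hP.isPrime.prod_le.1 h
    rw [← w.isMaximal.eq_of_le hP.ne_top hwP]
    exact (Finset.mem_filter.1 hw).2
  · let v : IsDedekindDomain.HeightOneSpectrum R :=
      ⟨P, hP.isPrime, fun e => hT (by rw [e] at hTP; simpa using hTP)⟩
    refine Ideal.le_of_dvd (Finset.dvd_prod_of_mem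
      (fun v : IsDedekindDomain.HeightOneSpectrum R => v.asIdeal) (a := v) ?_)
    rw [Finset.mem_filter, Set.Finite.mem_toFinset]
    exact ⟨Ideal.dvd_iff_le.2 hTP, h⟩

/-- If `u` generates `M` modulo `M T + M N`, then some `u + δ` with `δ ∈ M N` generates `M`
modulo `M T`. -/
theorem exists_add_generates {M : FractionalIdeal R⁰ F} (hM : M ≠ 0) {T N : Ideal R}
    (hT : T ≠ 0) (hN : N ≠ 0) {u : F}
    (h : spanSingleton R⁰ u + M * T + M * N = M) :
    ∃ δ ∈ M * (N : FractionalIdeal R⁰ F), spanSingleton R⁰ (u + δ) + M * T = M := by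
  have hu : u ∈ M := by
    rw [← spanSingleton_le_iff_mem, ← h, add_assoc]
    exact le_self_add
  -- `D` collects the primes above `T` at which `u` already generates `M`. A generator `δ` of `M N
  -- D` modulo `M N D T` vanishes at those primes and generates `M` at the other primes above `T`,
  -- where `N` is trivial by `h`.
  obtain ⟨D, hD, hDP⟩ :=
    exists_ideal_le_iff hT (fun P => u ∉ M * (P : FractionalIdeal R⁰ F))
  have hND : N * D ≠ 0 := mul_ne_zero hN hD
  obtain ⟨δ, hδ⟩ := IsDedekindDomain.exists_add_spanSingleton_mul_eq
    (a := M * ((N * D * T : Ideal R) : FractionalIdeal R⁰ F))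
    (c := M * ((N * D : Ideal R) : FractionalIdeal R⁰ F)) (b := 1)
    ((mul_coeIdeal_le_mul_coeIdeal hM).2 Ideal.mul_le_left)
    (mul_ne_zero hM (coeIdeal_ne_zero.2 (mul_ne_zero hND hT))) one_ne_zero
  rw [mul_one] at hδ
  have hδm : δ ∈ M * ((N * D : Ideal R) : FractionalIdeal R⁰ F) := by
    rw [← spanSingleton_le_iff_mem, ← hδ]
    exact le_add_self
  have hδN : δ ∈ M * (N : FractionalIdeal R⁰ F) :=
    (mul_coeIdeal_le_mul_coeIdeal hM).2 Ideal.mul_le_left hδm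
  refine ⟨δ, hδN, eq_of_forall_maximal hM ?_ ?_⟩
  · rw [add_le_iff, spanSingleton_le_iff_mem]
    exact ⟨(M : Submodule R F).add_mem hu (mul_coeIdeal_le M N hδN), mul_coeIdeal_le M T⟩
  intro P hP hle
  rw [add_le_iff, spanSingleton_le_iff_mem, mul_coeIdeal_le_mul_coeIdeal hM] at hle
  obtain ⟨h1, hTP⟩ := hle
  -- At a prime above `T`, exactly one of `u` and `δ` lies in `M P`, so the sum does not.
  by_cases hup : u ∈ M * (P : FractionalIdeal R⁰ F)
  · have hδP : δ ∈ M * (P : FractionalIdeal R⁰ F) := by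
      simpa using sub_mem_fractionalIdeal h1 hup
    have h2 : N * D ≤ P := by
      rw [← mul_coeIdeal_le_mul_coeIdeal hM, ← hδ, add_le_iff,
        spanSingleton_le_iff_mem, mul_coeIdeal_le_mul_coeIdeal hM]
      exact ⟨Ideal.mul_le_right.trans hTP, hδP⟩
    rcases hP.isPrime.mul_le.1 h2 with h3 | h3
    · have h4 : M ≤ M * (P : FractionalIdeal R⁰ F) := by
        conv_lhs => rw [← h]
        rw [add_le_iff, add_le_iff, spanSingleton_le_iff_mem,
          mul_coeIdeal_le_mul_coeIdeal hM, mul_coeIdeal_le_mul_coeIdeal hM]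
        exact ⟨⟨hup, hTP⟩, h3⟩
      have h5 : (⊤ : Ideal R) ≤ P := by
        rw [← mul_coeIdeal_le_mul_coeIdeal hM]
        simpa using h4
      exact hP.ne_top (top_le_iff.1 h5)
    · exact (hDP P hP hTP).1 h3 hup
  · have hδP : δ ∈ M * (P : FractionalIdeal R⁰ F) :=
      (mul_coeIdeal_le_mul_coeIdeal hM).2
        (Ideal.mul_le_right.trans ((hDP P hP hTP).2 hup)) hδm
    exact hup (by simpa using sub_mem_fractionalIdeal h1 hδP)

/-- A pair `(u, v)` with `u A + v B + D N = D` can be changed modulo `N` so that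
`u A + v B = D`. -/
theorem exists_unimodular {A B D : FractionalIdeal R⁰ F} (hA : A ≠ 0) (hB : B ≠ 0)
    (hD : D ≠ 0) {N : Ideal R} (hN : N ≠ 0) {u v : F}
    (h : spanSingleton R⁰ u * A + spanSingleton R⁰ v * B + D * N = D) :
    ∃ δ ∈ D * A⁻¹ * (N : FractionalIdeal R⁰ F), ∃ ε ∈ D * B⁻¹ * (N : FractionalIdeal R⁰ F),
      spanSingleton R⁰ (u + δ) * A + spanSingleton R⁰ (v + ε) * B = D := by
  have hDBN : D * B⁻¹ * (N : FractionalIdeal R⁰ F) ≠ 0 :=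
    mul_ne_zero (mul_ne_zero hD (inv_ne_zero hB)) (coeIdeal_ne_zero.2 hN)
  -- `ε` serves only to make the second coefficient nonzero, so that `T` below is a nonzero ideal.
  obtain ⟨ε, hε, hv⟩ : ∃ ε ∈ D * B⁻¹ * (N : FractionalIdeal R⁰ F), v + ε ≠ 0 := by
    by_cases hv : v = 0
    · obtain ⟨ε, hε, h0⟩ := FractionalIdeal.exists_ne_zero_mem_isInteger hDBN
      exact ⟨_, h0, by simpa [hv] using hε⟩
    · exact ⟨0, FractionalIdeal.zero_mem _, by simpa using hv⟩
  have key : spanSingleton R⁰ u * A + spanSingleton R⁰ (v + ε) * B + D * N = D := by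
    have e1 : ∀ x y : F, y ∈ D * B⁻¹ * (N : FractionalIdeal R⁰ F) →
        spanSingleton R⁰ (x + y) * B ≤ spanSingleton R⁰ x * B + D * N := by
      intro x y hy
      have h1 : spanSingleton R⁰ (x + y) ≤ spanSingleton R⁰ x + D * B⁻¹ * N := by
        rw [spanSingleton_le_iff_mem, mem_add_iff]
        exact ⟨x, mem_spanSingleton_self _ _, y, hy, rfl⟩
      calc _ ≤ (spanSingleton R⁰ x + D * B⁻¹ * N) * B := by gcongr
        _ = spanSingleton R⁰ x * B + D * N := by field_simp
    apply le_antisymm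
    · conv_rhs => rw [← h]
      rw [add_le_iff, add_le_iff]
      refine ⟨⟨?_, (e1 v ε hε).trans ?_⟩, le_add_self⟩
      · rw [add_assoc]; exact le_self_add
      · rw [add_assoc]; exact le_add_self
    · conv_lhs => rw [← h]
      rw [add_le_iff, add_le_iff]
      have e2 := e1 (v + ε) (-ε) (Submodule.neg_mem
        (↑(D * B⁻¹ * (N : FractionalIdeal R⁰ F)) : Submodule R F) hε)
      rw [add_neg_cancel_right] at e2
      refine ⟨⟨?_, e2.trans ?_⟩, le_add_self⟩
      · rw [add_assoc]; exact le_self_add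
      · rw [add_assoc]; exact le_add_self
  have hvB : D⁻¹ * (spanSingleton R⁰ (v + ε) * B) ≤ 1 := by
    calc _ ≤ D⁻¹ * D := by
          gcongr
          conv_rhs => rw [← key]
          rw [add_right_comm]
          exact le_add_self
      _ = 1 := inv_mul_cancel₀ hD
  -- With `D T = (v + ε) B`, division of `key` by `A` gives the hypothesis of `exists_add_generates`
  -- for `M = D A⁻¹`.
  obtain ⟨T, hT⟩ := le_one_iff_exists_coeIdeal.1 hvB
  have hT0 : T ≠ 0 := by
    rintro rfl
    rw [Submodule.zero_eq_bot, coeIdeal_bot] at hT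
    simp [hD, hB, spanSingleton_eq_zero_iff, hv] at hT
  have hDT : D * (T : FractionalIdeal R⁰ F) = spanSingleton R⁰ (v + ε) * B := by
    rw [hT, mul_inv_cancel_left₀ hD]
  obtain ⟨δ, hδ, e⟩ := exists_add_generates (M := D * A⁻¹) (mul_ne_zero hD (inv_ne_zero hA))
    hT0 hN (u := u) (by
      calc spanSingleton R⁰ u + D * A⁻¹ * T + D * A⁻¹ * N
          = (spanSingleton R⁰ u * A + D * T + D * N) * A⁻¹ := by field_simp
        _ = D * A⁻¹ := by rw [hDT, key])
  refine ⟨δ, hδ, ε, hε, ?_⟩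
  calc spanSingleton R⁰ (u + δ) * A + spanSingleton R⁰ (v + ε) * B
      = (spanSingleton R⁰ (u + δ) + D * A⁻¹ * T) * A := by rw [← hDT]; field_simp
    _ = D := by rw [e]; field_simp

end Dedekind

/-- The invertible matrix with rows `(a, b)` and `(c, d)`. -/
def mkGL {F : Type*} [Field F] (a b c d : F) (h : a * d - b * c ≠ 0) : GL (Fin 2) F :=
  Matrix.GeneralLinearGroup.mkOfDetNeZero !![a, b; c, d] (by rwa [Matrix.det_fin_two_of])

theorem mkGL_inv_of_det_one {F : Type*} [Field F] (a b c d : F) (h : a * d - b * c = 1) (h' h'') :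
    (mkGL a b c d h')⁻¹ = mkGL d (-b) (-c) a h'' := by
  rw [inv_eq_iff_mul_eq_one]
  ext i j
  fin_cases i <;> fin_cases j <;>
  simp [mkGL, Matrix.GeneralLinearGroup.mkOfDetNeZero, Matrix.mul_apply, Fin.sum_univ_two] <;>
  first | ring1 | linear_combination h

theorem mkGL_inv_diag {F : Type*} [Field F] (t : F) (ht : t ≠ 0) (h h') :
    (mkGL t 0 0 1 h)⁻¹ = mkGL t⁻¹ 0 0 1 h' := by
  rw [inv_eq_iff_mul_eq_one]
  ext i j
  fin_cases i <;> fin_cases j <;>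
  simp [mkGL, Matrix.GeneralLinearGroup.mkOfDetNeZero, Matrix.mul_apply, Fin.sum_univ_two, ht]

/-! ### Row vectors over `K` and the action of matrices on direct sums of ideals. -/

section RowSpace

variable {K : Type*} [Field K] [NumberField K]

/-- The row vector `(x, y)` with entries in `K`. -/
def vec (x y : K) : RowSpace K := ![algebraMap K (KHat K) x, algebraMap K (KHat K) y]

theorem algebraMap_KHat_injective : Function.Injective (algebraMap K (KHat K)) :=
  (algebraMap K (KHat K)).injective

theorem vec_inj {x y x' y' : K} : vec x y = vec x' y' ↔ x = x' ∧ y = y' := by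
  refine ⟨fun h => ⟨algebraMap_KHat_injective (congrFun h 0),
    algebraMap_KHat_injective (congrFun h 1)⟩, ?_⟩
  rintro ⟨rfl, rfl⟩
  rfl

theorem vec_add (x y x' y' : K) : vec x y + vec x' y' = vec (x + x') (y + y') := by
  simp only [vec, map_add, Matrix.cons_add_cons, Matrix.empty_add_empty]

theorem vec_sub (x y x' y' : K) : vec x y - vec x' y' = vec (x - x') (y - y') := by
  simp only [vec, map_sub, Matrix.cons_sub_cons, Matrix.empty_sub_empty]

theorem smul_vec (r x y : K) : r • vec x y = vec (r * x) (r * y) := by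
  rw [vec, Matrix.smul_cons, Matrix.smul_cons, Matrix.smul_empty, Algebra.smul_def,
    Algebra.smul_def, ← map_mul, ← map_mul]
  rfl

theorem integer_smul_vec (r : 𝓞 K) (x y : K) : r • vec x y = vec (r * x) (r * y) := by
  rw [← smul_vec, ← IsScalarTower.algebraMap_smul K r (vec x y)]

variable (K) in
/-- `vec` as a linear map. -/
def vecLinear : K × K →ₗ[K] RowSpace K where
  toFun v := vec v.1 v.2
  map_add' _ _ := (vec_add _ _ _ _).symm
  map_smul' _ _ := (smul_vec _ _ _).symm

theorem vecLinear_injective : Function.Injective (vecLinear K) := fun _ _ h =>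
  Prod.ext (vec_inj.1 h).1 (vec_inj.1 h).2

theorem vec_mem_oplus {A B : FractionalIdeal (𝓞 K)⁰ K} {x y : K} :
    vec x y ∈ oplus A B ↔ x ∈ A ∧ y ∈ B := by
  constructor
  · rintro ⟨x', hx, y', hy, h⟩
    obtain ⟨rfl, rfl⟩ := vec_inj.1 h
    exact ⟨hx, hy⟩
  · exact fun h => ⟨x, h.1, y, h.2, rfl⟩

theorem oplus_mono {A B C D : FractionalIdeal (𝓞 K)⁰ K} (hA : A ≤ C) (hB : B ≤ D) :
    oplus A B ≤ oplus C D := by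
  rintro _ ⟨x, hx, y, hy, rfl⟩
  exact ⟨x, hA hx, y, hB hy, rfl⟩

theorem rightMul_apply (U : GG K) (v : RowSpace K) :
    rightMul U v = Matrix.vecMul v (U : Matrix (Fin 2) (Fin 2) (KHat K)) := rfl

theorem rightMul_mul (U V : GG K) (v : RowSpace K) :
    rightMul (U * V) v = rightMul V (rightMul U v) := by
  simp only [rightMul_apply, Units.val_mul, Matrix.vecMul_vecMul]

theorem rightMul_one (v : RowSpace K) : rightMul (1 : GG K) v = v := by
  simp only [rightMul_apply, Units.val_one, Matrix.vecMul_one]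

theorem rightMul_smul (U : GG K) (k : KHat K) (v : RowSpace K) :
    rightMul U (k • v) = k • rightMul U v := by
  simp only [rightMul_apply, Matrix.smul_vecMul]

/-- Right multiplication by an element of `GL(2, KHat K)`, as a linear equivalence. -/
def rightMulEquiv (U : GG K) : RowSpace K ≃ₗ[𝓞 K] RowSpace K :=
  LinearEquiv.ofLinearMap (rightMul U) (rightMul U⁻¹)
    (LinearMap.ext fun v => by
      rw [LinearMap.comp_apply, ← rightMul_mul, inv_mul_cancel, rightMul_one, LinearMap.id_apply])
    (LinearMap.ext fun v => by
      rw [LinearMap.comp_apply, ← rightMul_mul, mul_inv_cancel, rightMul_one, LinearMap.id_apply])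

theorem rightMul_injective (U : GG K) : Function.Injective (rightMul U) :=
  (rightMulEquiv U).injective

theorem map_rightMul_mul (L : Submodule (𝓞 K) (RowSpace K)) (U V : GG K) :
    L.map (rightMul (U * V)) = (L.map (rightMul U)).map (rightMul V) := by
  rw [← Submodule.map_comp]
  congr 1
  exact LinearMap.ext (rightMul_mul U V)

theorem map_rightMul_one (L : Submodule (𝓞 K) (RowSpace K)) : L.map (rightMul 1) = L := by
  rw [show rightMul (1 : GG K) = LinearMap.id from LinearMap.ext rightMul_one, Submodule.map_id]

theorem map_rightMul_eq_iff {L L' : Submodule (𝓞 K) (RowSpace K)} {U : GG K} :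
    L.map (rightMul U) = L' ↔ L = L'.map (rightMul U⁻¹) := by
  constructor
  · rintro rfl
    rw [← map_rightMul_mul, mul_inv_cancel, map_rightMul_one]
  · rintro rfl
    rw [← map_rightMul_mul, inv_mul_cancel, map_rightMul_one]

theorem rightMul_toGG_vec (g : GL (Fin 2) K) (x y : K) :
    rightMul (toGG g) (vec x y) =
      vec (x * g 0 0 + y * g 1 0) (x * g 0 1 + y * g 1 1) := by
  rw [rightMul_apply]
  ext i
  fin_cases i <;>
  simp [vec, Matrix.vecMul, dotProduct, Fin.sum_univ_two, TensorProduct.add_tmul]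

/-- Testing on the two axes decouples the inclusion into one condition per entry. Together with
`mem_mul_inv_iff` this turns questions about lattices into ideal membership. -/
theorem map_oplus_le_iff {A B C D : FractionalIdeal (𝓞 K)⁰ K} {g : GL (Fin 2) K} :
    (oplus A B).map (rightMul (toGG g)) ≤ oplus C D ↔
      (∀ x ∈ A, x * g 0 0 ∈ C) ∧ (∀ x ∈ A, x * g 0 1 ∈ D) ∧
      (∀ y ∈ B, y * g 1 0 ∈ C) ∧ (∀ y ∈ B, y * g 1 1 ∈ D) := by
  rw [Submodule.map_le_iff_le_comap]
  constructor
  · intro h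
    have h1 : ∀ x ∈ A, x * g 0 0 ∈ C ∧ x * g 0 1 ∈ D := fun x hx => by
      have := h (vec_mem_oplus.2 ⟨hx, B.zero_mem⟩)
      rw [Submodule.mem_comap, rightMul_toGG_vec, vec_mem_oplus] at this
      simpa using this
    have h2 : ∀ y ∈ B, y * g 1 0 ∈ C ∧ y * g 1 1 ∈ D := fun y hy => by
      have := h (vec_mem_oplus.2 ⟨A.zero_mem, hy⟩)
      rw [Submodule.mem_comap, rightMul_toGG_vec, vec_mem_oplus] at this
      simpa using this
    exact ⟨fun x hx => (h1 x hx).1, fun x hx => (h1 x hx).2, fun y hy => (h2 y hy).1,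
      fun y hy => (h2 y hy).2⟩
  · rintro ⟨h1, h2, h3, h4⟩ _ ⟨x, hx, y, hy, rfl⟩
    rw [Submodule.mem_comap]
    refine (rightMul_toGG_vec g x y).symm ▸ vec_mem_oplus.2 ⟨?_, ?_⟩
    · exact frac_add (h1 x hx) (h3 y hy)
    · exact frac_add (h2 x hx) (h4 y hy)

theorem map_oplus_eq {A B C D : FractionalIdeal (𝓞 K)⁰ K} {g : GL (Fin 2) K}
    (h : (oplus A B).map (rightMul (toGG g)) ≤ oplus C D)
    (h' : (oplus C D).map (rightMul (toGG g⁻¹)) ≤ oplus A B) :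
    (oplus A B).map (rightMul (toGG g)) = oplus C D := by
  refine le_antisymm h ?_
  have := Submodule.map_mono (f := rightMul (toGG g)) h'
  rwa [← map_rightMul_mul, ← map_mul, inv_mul_cancel, map_one, map_rightMul_one] at this

end RowSpace

/-! ### Completing a unimodular column to a matrix. -/

section Transport

variable {K : Type*} [Field K] [NumberField K]

theorem mem_mul_inv_iff {I J : FractionalIdeal (𝓞 K)⁰ K} (hI : I ≠ 0) {w : K} :
    w ∈ J * I⁻¹ ↔ ∀ x ∈ I, x * w ∈ J := by
  constructor
  · intro hw x hx
    have := mul_mem_mul hw hx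
    rwa [inv_mul_cancel_right₀ hI, mul_comm] at this
  · intro h
    rw [← spanSingleton_le_iff_mem]
    have h1 : I * spanSingleton (𝓞 K)⁰ w ≤ J := by
      rw [mul_comm, spanSingleton_mul_le_iff]
      exact fun x hx => mul_comm x w ▸ h x hx
    calc spanSingleton (𝓞 K)⁰ w = I * spanSingleton (𝓞 K)⁰ w * I⁻¹ := by field_simp
      _ ≤ J * I⁻¹ := by gcongr

/-- A linear map on `A ⊕ B` with second column `(u, v)`, where `u A + v B = D`, that carries
`A ⊕ B` to `C ⊕ D` whenever `A B = C D`. -/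
theorem exists_map_oplus_eq_of_column {A B C D : FractionalIdeal (𝓞 K)⁰ K} (hA : A ≠ 0)
    (hB : B ≠ 0) (hD : D ≠ 0) (h : A * B = C * D) {u v : K}
    (huv : spanSingleton (𝓞 K)⁰ u * A + spanSingleton (𝓞 K)⁰ v * B = D) :
    ∃ g : GL (Fin 2) K, g 0 1 = u ∧ g 1 1 = v ∧
      (oplus A B).map (rightMul (toGG g)) = oplus C D := by
  -- Dividing `u A + v B = D` by `D` yields the Bézout coefficients that become the first column.
  have h1 : (1 : K) ∈ spanSingleton (𝓞 K)⁰ u * (A * D⁻¹) +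
      spanSingleton (𝓞 K)⁰ v * (B * D⁻¹) := by
    rw [← mul_assoc, ← mul_assoc, ← add_mul, huv, mul_inv_cancel₀ hD]
    exact one_mem_one _
  obtain ⟨s, hs, t, ht, hst⟩ := mem_add_iff.1 h1
  obtain ⟨α, hα, rfl⟩ := mem_singleton_mul.1 hs
  obtain ⟨γ, hγ, rfl⟩ := mem_singleton_mul.1 ht
  have hdet : γ * v - u * -α = 1 := by linear_combination hst
  have hdet' : v * γ - -u * - -α = 1 := by linear_combination hst
  have hdv : ∀ {I J : FractionalIdeal (𝓞 K)⁰ K} {x y : K}, x ∈ I → y ∈ J * D⁻¹ →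
      x * y ∈ I * J * D⁻¹ := fun hx hy => by
    rw [mul_assoc]; exact mul_mem_mul hx hy
  have hcancel : C * D * D⁻¹ = C := mul_inv_cancel_right₀ hD C
  have huA : ∀ x ∈ A, x * u ∈ D := fun x hx => by
    rw [mul_comm, ← huv]
    exact mem_add_iff.2 ⟨_, mul_mem_mul (mem_spanSingleton_self _ _) hx, 0,
      FractionalIdeal.zero_mem _, add_zero _⟩
  have hvB : ∀ x ∈ B, x * v ∈ D := fun x hx => by
    rw [mul_comm, ← huv]
    exact mem_add_iff.2 ⟨0, FractionalIdeal.zero_mem _, _,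
      mul_mem_mul (mem_spanSingleton_self _ _) hx, zero_add _⟩
  -- The entries `γ` and `α` lie in `B D⁻¹` and `A D⁻¹`, so `A B = C D` sends both summands into
  -- `C`; the inverse matrix is handled by the same identity.
  refine ⟨mkGL γ u (-α) v (by rw [hdet]; exact one_ne_zero), rfl, rfl, map_oplus_eq ?_ ?_⟩
  · rw [map_oplus_le_iff]
    refine ⟨fun x hx => ?_, huA, fun y hy => ?_, hvB⟩
    · have := hdv hx hγ
      rwa [h, hcancel] at this
    · have := hdv hy hα
      rw [mul_comm B, h, hcancel] at this
      have := frac_neg this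
      rwa [← mul_neg] at this
  · rw [mkGL_inv_of_det_one _ _ _ _ hdet _ (by
      rw [show v * γ - -u * - -α = 1 from hdet']; exact one_ne_zero), map_oplus_le_iff]
    refine ⟨fun x hx => ?_, fun x hx => ?_, fun y hy => ?_, fun y hy => ?_⟩
    · have := mul_mem_mul hx ((mem_mul_inv_iff hB).2 hvB)
      rwa [← mul_assoc, ← h, mul_inv_cancel_right₀ hB] at this
    · have := mul_mem_mul hx ((mem_mul_inv_iff hA).2 huA)
      rw [← mul_assoc, ← h, mul_comm A, mul_inv_cancel_right₀ hA] at this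
      have := frac_neg this
      rwa [← mul_neg] at this
    · change y * - -α ∈ A
      rw [neg_neg]
      have := mul_mem_mul hα hy
      rwa [inv_mul_cancel_right₀ hD, mul_comm] at this
    · have := mul_mem_mul hγ hy
      rwa [inv_mul_cancel_right₀ hD, mul_comm] at this

end Transport

/-! ### The Steinitz class of a direct sum of two ideals. -/

section SteinitzClass

variable {K : Type*} [Field K] [NumberField K]

theorem exists_map_oplus_eq_smul {A B : FractionalIdeal (𝓞 K)⁰ K} {t : K} (ht : t ≠ 0) :
    ∃ g : GL (Fin 2) K,
      (oplus A B).map (rightMul (toGG g)) = oplus (spanSingleton (𝓞 K)⁰ t * A) B := by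
  refine ⟨mkGL t 0 0 1 (by simpa using ht), map_oplus_eq ?_ ?_⟩
  · rw [map_oplus_le_iff]
    refine ⟨fun x hx => ?_, fun x _ => ?_, fun y _ => ?_, fun y hy => ?_⟩
    · change x * t ∈ _
      rw [mul_comm x]
      exact mul_mem_mul (mem_spanSingleton_self _ _) hx
    · change x * 0 ∈ _
      simpa using FractionalIdeal.zero_mem _
    · change y * 0 ∈ _
      simpa using FractionalIdeal.zero_mem _
    · change y * 1 ∈ _
      simpa using hy
  · rw [mkGL_inv_diag t ht _ (by simpa using ht), map_oplus_le_iff]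
    refine ⟨fun x hx => ?_, fun x _ => ?_, fun y _ => ?_, fun y hy => ?_⟩
    · change x * t⁻¹ ∈ _
      obtain ⟨z, hz, rfl⟩ := mem_singleton_mul.1 hx
      rwa [mul_comm t, mul_inv_cancel_right₀ ht]
    · change x * 0 ∈ _
      simpa using FractionalIdeal.zero_mem _
    · change y * 0 ∈ _
      simpa using FractionalIdeal.zero_mem _
    · change y * 1 ∈ _
      simpa using hy

/-- Direct sums of two fractional ideals with the same product up to scaling are equivalent under
`GL(2, K)`. -/
theorem exists_map_oplus_eq {A B C D : FractionalIdeal (𝓞 K)⁰ K} (hA : A ≠ 0) (hB : B ≠ 0)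
    (hD : D ≠ 0) {t : K} (ht : t ≠ 0) (h : spanSingleton (𝓞 K)⁰ t * (A * B) = C * D) :
    ∃ g : GL (Fin 2) K, (oplus A B).map (rightMul (toGG g)) = oplus C D := by
  obtain ⟨g₁, hg₁⟩ := exists_map_oplus_eq_smul (A := A) (B := B) ht
  have hA' : spanSingleton (𝓞 K)⁰ t * A ≠ 0 :=
    mul_ne_zero (spanSingleton_ne_zero_iff.2 ht) hA
  -- Any nonzero `u` in `D (t A)⁻¹` can start a column: over a Dedekind domain the subideal `u t A`
  -- of `D` is completed to `D` by a suitable multiple of `B`.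
  obtain ⟨u, hu, hu0⟩ : ∃ u : K, u ≠ 0 ∧
      spanSingleton (𝓞 K)⁰ u * (spanSingleton (𝓞 K)⁰ t * A) ≤ D := by
    obtain ⟨x, hx, h0⟩ := exists_ne_zero_mem_isInteger
      (mul_ne_zero hD (inv_ne_zero hA'))
    refine ⟨algebraMap (𝓞 K) K x, by simpa using hx, ?_⟩
    calc _ ≤ D * (spanSingleton (𝓞 K)⁰ t * A)⁻¹ * (spanSingleton (𝓞 K)⁰ t * A) := by
            gcongr
            exact spanSingleton_le_iff_mem.2 h0
        _ = D := inv_mul_cancel_right₀ hA' D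
  obtain ⟨v, hv⟩ := IsDedekindDomain.exists_add_spanSingleton_mul_eq hu0
    (mul_ne_zero (spanSingleton_ne_zero_iff.2 hu) hA') hB
  obtain ⟨g₂, -, -, hg₂⟩ := exists_map_oplus_eq_of_column hA' hB hD
    (by rw [mul_assoc, h]) hv
  exact ⟨g₁ * g₂, by rw [map_mul, map_rightMul_mul, hg₁, hg₂]⟩

/-- A linear map from a fractional ideal to `K` is multiplication by a scalar. -/
theorem exists_eq_mul_of_linearMap (A : FractionalIdeal (𝓞 K)⁰ K)
    (f : (A : Submodule (𝓞 K) K) →ₗ[𝓞 K] K) : ∃ t : K, ∀ x, f x = x * t := by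
  by_cases hA : ∃ a : (A : Submodule (𝓞 K) K), (a : K) ≠ 0
  · obtain ⟨a, ha⟩ := hA
    refine ⟨f a / a, fun x => ?_⟩
    obtain ⟨r, s, hs, hrs⟩ := IsFractionRing.div_surjective (A := 𝓞 K) ((x : K) / a)
    have hs0 : algebraMap (𝓞 K) K s ≠ 0 :=
      IsFractionRing.to_map_ne_zero_of_mem_nonZeroDivisors hs
    have h1 : algebraMap (𝓞 K) K s * x = algebraMap (𝓞 K) K r * a := by
      field_simp at hrs
      linear_combination -hrs
    have h2 : s • x = r • a := by
      ext1
      rw [Submodule.coe_smul, Submodule.coe_smul, Algebra.smul_def, Algebra.smul_def, h1]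
    have h3 := congrArg f h2
    rw [map_smul, map_smul, Algebra.smul_def, Algebra.smul_def] at h3
    apply mul_left_cancel₀ hs0
    rw [h3]
    field_simp
    linear_combination (-f a) * h1
  · push Not at hA
    refine ⟨0, fun x => ?_⟩
    rw [show x = 0 from Subtype.ext (hA x), map_zero, mul_zero]

/-- For `x` in `A` and `y` in `B`, `x y` times the determinant is `(x a)(y d) - (y c)(x b)`. Applied
to a map and to its inverse, this pins down the product of the ideals and makes stabilizer
determinants units. -/
theorem spanSingleton_det_mul_le {A B C D : FractionalIdeal (𝓞 K)⁰ K} {a b c d : K}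
    (ha : ∀ x ∈ A, x * a ∈ C) (hb : ∀ x ∈ A, x * b ∈ D) (hc : ∀ y ∈ B, y * c ∈ C)
    (hd : ∀ y ∈ B, y * d ∈ D) :
    spanSingleton (𝓞 K)⁰ (a * d - b * c) * (A * B) ≤ C * D := by
  rw [← mul_assoc, mul_le]
  intro z hz y hy
  obtain ⟨x, hx, rfl⟩ := mem_singleton_mul.1 hz
  have := sub_mem_fractionalIdeal (mul_mem_mul (ha x hx) (hd y hy))
    (mul_mem_mul (hc y hy) (hb x hx))
  convert this using 1
  ring

/-- Isomorphic direct sums of two fractional ideals have the same product up to scaling. -/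
theorem exists_smul_mul_eq_of_equiv {A B C D : FractionalIdeal (𝓞 K)⁰ K}
    (hA : A ≠ 0) (hB : B ≠ 0)
    (e : (↥(A : Submodule (𝓞 K) K) × ↥(B : Submodule (𝓞 K) K)) ≃ₗ[𝓞 K]
      (↥(C : Submodule (𝓞 K) K) × ↥(D : Submodule (𝓞 K) K))) :
    ∃ t : K, t ≠ 0 ∧ spanSingleton (𝓞 K)⁰ t * (A * B) = C * D := by
  have key : ∀ {A B C D : FractionalIdeal (𝓞 K)⁰ K}
      (f : (↥(A : Submodule (𝓞 K) K) × ↥(B : Submodule (𝓞 K) K)) →ₗ[𝓞 K]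
      (↥(C : Submodule (𝓞 K) K) × ↥(D : Submodule (𝓞 K) K))), ∃ a b c d : K,
      (∀ x y, ((f (x, y)).1 : K) = x * a + y * c ∧ ((f (x, y)).2 : K) = x * b + y * d) ∧
      spanSingleton (𝓞 K)⁰ (a * d - b * c) * (A * B) ≤ C * D := by
    intro A B C D f
    obtain ⟨a, ha⟩ := exists_eq_mul_of_linearMap A
      ((C : Submodule (𝓞 K) K).subtype ∘ₗ LinearMap.fst _ _ _ ∘ₗ f ∘ₗ LinearMap.inl _ _ _)
    obtain ⟨b, hb⟩ := exists_eq_mul_of_linearMap A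
      ((D : Submodule (𝓞 K) K).subtype ∘ₗ LinearMap.snd _ _ _ ∘ₗ f ∘ₗ LinearMap.inl _ _ _)
    obtain ⟨c, hc⟩ := exists_eq_mul_of_linearMap B
      ((C : Submodule (𝓞 K) K).subtype ∘ₗ LinearMap.fst _ _ _ ∘ₗ f ∘ₗ LinearMap.inr _ _ _)
    obtain ⟨d, hd⟩ := exists_eq_mul_of_linearMap B
      ((D : Submodule (𝓞 K) K).subtype ∘ₗ LinearMap.snd _ _ _ ∘ₗ f ∘ₗ LinearMap.inr _ _ _)
    simp only [LinearMap.comp_apply, LinearMap.inl_apply, LinearMap.inr_apply,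
      LinearMap.fst_apply, LinearMap.snd_apply, Submodule.subtype_apply] at ha hb hc hd
    refine ⟨a, b, c, d, fun x y => ?_, spanSingleton_det_mul_le ?_ ?_ ?_ ?_⟩
    · have : f (x, y) = f (x, 0) + f (0, y) := by
        rw [← map_add, Prod.mk_add_mk, add_zero, zero_add]
      rw [this, ← ha, ← hb, ← hc, ← hd]
      exact ⟨rfl, rfl⟩
    · exact fun x hx => ha ⟨x, hx⟩ ▸ (f (⟨x, hx⟩, 0)).1.2
    · exact fun x hx => hb ⟨x, hx⟩ ▸ (f (⟨x, hx⟩, 0)).2.2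
    · exact fun x hx => hc ⟨x, hx⟩ ▸ (f (0, ⟨x, hx⟩)).1.2
    · exact fun x hx => hd ⟨x, hx⟩ ▸ (f (0, ⟨x, hx⟩)).2.2
  obtain ⟨a, b, c, d, hf, hle⟩ := key e.toLinearMap
  obtain ⟨a', b', c', d', hf', hle'⟩ := key e.symm.toLinearMap
  simp only [LinearEquiv.coe_coe] at hf hf'
  have comp : ∀ (x : ↥(A : Submodule (𝓞 K) K)) (y : ↥(B : Submodule (𝓞 K) K)), (x : K) = (x * a + y * c) * a' + (x * b + y * d) * c' ∧
      (y : K) = (x * a + y * c) * b' + (x * b + y * d) * d' := by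
    intro x y
    have h := hf' (e (x, y)).1 (e (x, y)).2
    rw [Prod.mk.eta, e.symm_apply_apply, (hf x y).1, (hf x y).2] at h
    exact h
  have exists_ne : ∀ {A : FractionalIdeal (𝓞 K)⁰ K}, A ≠ 0 →
      ∃ x : (A : Submodule (𝓞 K) K), (x : K) ≠ 0 := by
    intro A hA
    obtain ⟨x, hx, h0⟩ := exists_ne_zero_mem_isInteger hA
    exact ⟨⟨_, h0⟩, by simpa using hx⟩
  -- Evaluation at a nonzero element of each summand shows that the two matrices over `K` are
  -- mutually inverse.
  obtain ⟨x, hx⟩ := exists_ne hA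
  obtain ⟨y, hy⟩ := exists_ne hB
  have hx1 := comp x 0
  have hy1 := comp 0 y
  simp only [ZeroMemClass.coe_zero, zero_mul, add_zero, zero_add] at hx1 hy1
  have e1 : a * a' + b * c' = 1 := mul_left_cancel₀ hx (by linear_combination -hx1.1)
  have e2 : a * b' + b * d' = 0 := mul_left_cancel₀ hx (by linear_combination -hx1.2)
  have e3 : c * a' + d * c' = 0 := mul_left_cancel₀ hy (by linear_combination -hy1.1)
  have e4 : c * b' + d * d' = 1 := mul_left_cancel₀ hy (by linear_combination -hy1.2)
  have hdet : (a * d - b * c) * (a' * d' - b' * c') = 1 := by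
    linear_combination (c * b' + d * d') * e1 + e4 - (c * a' + d * c') * e2
  refine ⟨a * d - b * c, left_ne_zero_of_mul_eq_one hdet, le_antisymm hle ?_⟩
  calc C * D = spanSingleton (𝓞 K)⁰ (a * d - b * c) *
        (spanSingleton (𝓞 K)⁰ (a' * d' - b' * c') * (C * D)) := by
        rw [← mul_assoc, spanSingleton_mul_spanSingleton, hdet, spanSingleton_one, one_mul]
    _ ≤ _ := by gcongr

/-- The direct sum of `A` and `B`, as a submodule of the row space. -/
def oplusEquiv (A B : FractionalIdeal (𝓞 K)⁰ K) :
    (↥(A : Submodule (𝓞 K) K) × ↥(B : Submodule (𝓞 K) K)) ≃ₗ[𝓞 K] oplus A B :=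
  LinearEquiv.ofBijective
    ((((vecLinear K).restrictScalars (𝓞 K)).comp
      ((A : Submodule (𝓞 K) K).subtype.prodMap (B : Submodule (𝓞 K) K).subtype)).codRestrict
        (oplus A B) fun v => vec_mem_oplus.2 ⟨v.1.2, v.2.2⟩)
    ⟨fun _ _ h => Prod.ext (Subtype.ext (vec_inj.1 (Subtype.ext_iff.1 h)).1)
        (Subtype.ext (vec_inj.1 (Subtype.ext_iff.1 h)).2),
      fun ⟨_, x, hx, y, hy, h⟩ => ⟨(⟨x, hx⟩, ⟨y, hy⟩), Subtype.ext h.symm⟩⟩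

/-- An integral ideal is isomorphic to the corresponding fractional ideal. -/
def coeIdealEquiv (I : Ideal (𝓞 K)) :
    I ≃ₗ[𝓞 K] ((I : FractionalIdeal (𝓞 K)⁰ K) : Submodule (𝓞 K) K) :=
  Submodule.equivMapOfInjective (Algebra.linearMap (𝓞 K) K)
    (FaithfulSMul.algebraMap_injective (𝓞 K) K) I

/-- `𝓞 K ⊕ 𝔞` as a submodule of the row space. -/
def prodIdealEquiv (a : (Ideal (𝓞 K))⁰) :
    (𝓞 K × (a : Ideal (𝓞 K))) ≃ₗ[𝓞 K] oplus ((⊤ : Ideal (𝓞 K)) : FractionalIdeal (𝓞 K)⁰ K)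
      (frac a) :=
  ((Submodule.topEquiv.symm.trans (coeIdealEquiv ⊤)).prodCongr (coeIdealEquiv _)).trans
    (oplusEquiv _ _)

theorem frac_ne_zero (a : (Ideal (𝓞 K))⁰) : frac a ≠ 0 :=
  coeIdeal_ne_zero.2 (nonZeroDivisors.coe_ne_zero a)

theorem hasClass_map_iff (L : Submodule (𝓞 K) (RowSpace K)) (U : GG K)
    (c : ClassGroup (𝓞 K)) : HasClass (L.map (rightMul U)) c ↔ HasClass L c := by
  have e : L ≃ₗ[𝓞 K] L.map (rightMul U) :=
    Submodule.equivMapOfInjective _ (rightMul_injective U) L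
  constructor
  · rintro ⟨a, ha, ⟨f⟩⟩
    exact ⟨a, ha, ⟨e.trans f⟩⟩
  · rintro ⟨a, ha, ⟨f⟩⟩
    exact ⟨a, ha, ⟨e.symm.trans f⟩⟩

/-- Steinitz in rank two: the determinant shows that the class of `A B` is an invariant, and
completion of a column shows that it suffices. -/
theorem hasClass_oplus_iff {A B : FractionalIdeal (𝓞 K)⁰ K} (hA : A ≠ 0) (hB : B ≠ 0)
    (a : (Ideal (𝓞 K))⁰) : HasClass (oplus A B) (ClassGroup.mk0 a) ↔
      ∃ t : K, t ≠ 0 ∧ spanSingleton (𝓞 K)⁰ t * (A * B) = frac a := by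
  constructor
  · rintro ⟨b, hb, ⟨f⟩⟩
    obtain ⟨t, ht, h⟩ := exists_smul_mul_eq_of_equiv hA hB
      (((oplusEquiv A B).trans (f.trans (prodIdealEquiv b))).trans (oplusEquiv _ _).symm)
    obtain ⟨s, hs, h'⟩ := (ClassGroup.mk0_eq_mk0_iff_exists_fraction_ring K).1 hb
    refine ⟨s * t, mul_ne_zero hs ht, ?_⟩
    rw [← spanSingleton_mul_spanSingleton, mul_assoc, h, coeIdeal_top, one_mul]
    exact h'
  · rintro ⟨t, ht, h⟩
    obtain ⟨g, hg⟩ := exists_map_oplus_eq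
      (C := ((⊤ : Ideal (𝓞 K)) : FractionalIdeal (𝓞 K)⁰ K)) hA hB (frac_ne_zero a) ht
      (by rw [coeIdeal_top, one_mul, h])
    rw [← hasClass_map_iff _ (toGG g), hg]
    exact ⟨a, rfl, ⟨(prodIdealEquiv a).symm⟩⟩

end SteinitzClass

/-! ### Lattices as direct sums of ideals, and cyclic quotients. -/

section Lattices

variable {K : Type*} [Field K] [NumberField K]

/-- Right multiplication as a `KHat K`-linear equivalence. -/
def rightMulHat (U : GG K) : RowSpace K ≃ₗ[KHat K] RowSpace K where
  toFun := rightMul U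
  map_add' := map_add _
  map_smul' := rightMul_smul U
  invFun := rightMul U⁻¹
  left_inv v := by rw [← rightMul_mul, mul_inv_cancel, rightMul_one]
  right_inv v := by rw [← rightMul_mul, inv_mul_cancel, rightMul_one]

theorem IsOKLattice.map {L : Submodule (𝓞 K) (RowSpace K)} (hL : IsOKLattice L) (U : GG K) :
    IsOKLattice (L.map (rightMul U)) := by
  have equiv : ∀ F : Submodule (𝓞 K) (RowSpace K), Nonempty (F ≃ₗ[𝓞 K] F.map (rightMul U)) :=
    fun F => ⟨Submodule.equivMapOfInjective _ (rightMul_injective U) F⟩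
  refine ⟨?_, ?_, hL.fg.map _, ?_⟩
  · have h : ((L.map (rightMul U) : Submodule (𝓞 K) (RowSpace K)) : Set (RowSpace K)) =
        (rightMulHat U).toLinearMap '' L := rfl
    rw [h, ← Submodule.map_span, hL.span_eq_top, Submodule.map_top, LinearEquiv.range]
  · obtain ⟨F₁, F₂, h₁, r₁, h₂, r₂, hF₁, hF₂⟩ := hL.between_free
    obtain ⟨e₁⟩ := equiv F₁
    obtain ⟨e₂⟩ := equiv F₂
    exact ⟨F₁.map (rightMul U), F₂.map (rightMul U), Module.Free.of_equiv e₁,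
      e₁.finrank_eq.symm.trans r₁, Module.Free.of_equiv e₂, e₂.finrank_eq.symm.trans r₂,
      Submodule.map_mono hF₁, Submodule.map_mono hF₂⟩
  · have h : ((L.map (rightMul U) : Submodule (𝓞 K) (RowSpace K)) : Set (RowSpace K)) =
        ((rightMulHat U).restrictScalars K).toLinearMap '' L := rfl
    rw [h, ← Submodule.map_span]
    exact (LinearEquiv.finrank_map_eq ((rightMulHat U).restrictScalars K) _).trans hL.finrank_span

theorem exists_mem_ne_zero {A : FractionalIdeal (𝓞 K)⁰ K} (hA : A ≠ 0) :
    ∃ x ∈ A, x ≠ 0 := by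
  obtain ⟨x, hx, h0⟩ := exists_ne_zero_mem_isInteger hA
  exact ⟨_, h0, by simpa using hx⟩

theorem free_oplus_spanSingleton {s t : K} (hs : s ≠ 0) (ht : t ≠ 0) :
    Module.Free (𝓞 K) (oplus (spanSingleton (𝓞 K)⁰ s) (spanSingleton (𝓞 K)⁰ t)) ∧
    Module.finrank (𝓞 K) (oplus (spanSingleton (𝓞 K)⁰ s) (spanSingleton (𝓞 K)⁰ t)) = 2 := by
  have e : ∀ x : K, x ≠ 0 →
      Nonempty (𝓞 K ≃ₗ[𝓞 K] (spanSingleton (𝓞 K)⁰ x : Submodule (𝓞 K) K)) := fun x hx =>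
    ⟨(LinearEquiv.toSpanNonzeroSingleton (𝓞 K) K x hx).trans
      (LinearEquiv.ofEq _ _ (coe_spanSingleton _ x).symm)⟩
  obtain ⟨es⟩ := e s hs
  obtain ⟨et⟩ := e t ht
  have f := (es.prodCongr et).trans (oplusEquiv _ _)
  refine ⟨Module.Free.of_equiv f, ?_⟩
  rw [← f.finrank_eq, Module.finrank_prod, Module.finrank_self]

theorem exists_le_spanSingleton (A : FractionalIdeal (𝓞 K)⁰ K) :
    ∃ t : K, t ≠ 0 ∧ A ≤ spanSingleton (𝓞 K)⁰ t := by
  obtain ⟨a, I, ha, h⟩ := exists_eq_spanSingleton_mul A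
  refine ⟨(algebraMap (𝓞 K) K a)⁻¹, inv_ne_zero (by simpa using ha), ?_⟩
  rw [h]
  calc _ ≤ spanSingleton (𝓞 K)⁰ (algebraMap (𝓞 K) K a)⁻¹ * 1 := by gcongr; exact coeIdeal_le_one
    _ = _ := mul_one _

theorem isOKLattice_oplus {A B : FractionalIdeal (𝓞 K)⁰ K} (hA : A ≠ 0) (hB : B ≠ 0) :
    IsOKLattice (oplus A B) := by
  obtain ⟨a, ha, ha0⟩ := exists_mem_ne_zero hA
  obtain ⟨b, hb, hb0⟩ := exists_mem_ne_zero hB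
  have hva : vec a 0 ∈ oplus A B := vec_mem_oplus.2 ⟨ha, B.zero_mem⟩
  have hvb : vec 0 b ∈ oplus A B := vec_mem_oplus.2 ⟨A.zero_mem, hb⟩
  refine ⟨?_, ?_, ?_, ?_⟩
  · refine eq_top_iff.2 fun w _ => ?_
    have h1 : ∀ x : K, x ≠ 0 → algebraMap K (KHat K) x⁻¹ * algebraMap K (KHat K) x = 1 :=
      fun x hx => by rw [← map_mul, inv_mul_cancel₀ hx, map_one]
    have : w = (w 0 * algebraMap K (KHat K) a⁻¹) • vec a 0 +
        (w 1 * algebraMap K (KHat K) b⁻¹) • vec 0 b := by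
      ext i
      fin_cases i
      · change w 0 = w 0 * algebraMap K (KHat K) a⁻¹ * algebraMap K (KHat K) a +
          w 1 * algebraMap K (KHat K) b⁻¹ * algebraMap K (KHat K) 0
        rw [mul_assoc, h1 a ha0, map_zero, mul_one, mul_zero, add_zero]
      · change w 1 = w 0 * algebraMap K (KHat K) a⁻¹ * algebraMap K (KHat K) 0 +
          w 1 * algebraMap K (KHat K) b⁻¹ * algebraMap K (KHat K) b
        rw [mul_assoc (w 1), h1 b hb0, map_zero, mul_one, mul_zero, zero_add]
    rw [this]
    exact add_mem (Submodule.smul_mem _ _ (Submodule.subset_span hva))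
      (Submodule.smul_mem _ _ (Submodule.subset_span hvb))
  -- Nonzero elements bound the summands below by principal ideals; common denominators bound them
  -- above.
  · obtain ⟨s, hs, hAs⟩ := exists_le_spanSingleton A
    obtain ⟨t, ht, hBt⟩ := exists_le_spanSingleton B
    exact ⟨_, _, (free_oplus_spanSingleton ha0 hb0).1, (free_oplus_spanSingleton ha0 hb0).2,
      (free_oplus_spanSingleton hs ht).1, (free_oplus_spanSingleton hs ht).2,
      oplus_mono (spanSingleton_le_iff_mem.2 ha) (spanSingleton_le_iff_mem.2 hb),
      oplus_mono hAs hBt⟩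
  · have hfin : ∀ I : FractionalIdeal (𝓞 K)⁰ K, Module.Finite (𝓞 K) (I : Submodule (𝓞 K) K) :=
      fun I => Module.Finite.iff_fg.2 (fg_of_isNoetherianRing le_rfl I)
    have := hfin A
    have := hfin B
    exact Module.Finite.iff_fg.1 (Module.Finite.equiv (oplusEquiv A B))
  · have h : Submodule.span K (oplus A B : Set (RowSpace K)) = LinearMap.range (vecLinear K) := by
      apply le_antisymm
      · rw [Submodule.span_le]
        rintro _ ⟨x, -, y, -, rfl⟩
        exact ⟨(x, y), rfl⟩
      · rintro _ ⟨⟨x, y⟩, rfl⟩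
        have : vecLinear K (x, y) = (x * a⁻¹) • vec a 0 + (y * b⁻¹) • vec 0 b := by
          rw [smul_vec, smul_vec, vec_add, inv_mul_cancel_right₀ ha0, inv_mul_cancel_right₀ hb0,
            mul_zero, mul_zero, add_zero, zero_add]
          rfl
        rw [this]
        exact add_mem (Submodule.smul_mem _ _ (Submodule.subset_span hva))
          (Submodule.smul_mem _ _ (Submodule.subset_span hvb))
    rw [h, LinearMap.finrank_range_of_inj vecLinear_injective, Module.finrank_prod,
      Module.finrank_self]

/-- A finitely generated submodule of `K × K` containing the standard basis splits as the sum of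
two fractional ideals, after a unipotent change of coordinates. -/
theorem exists_fractionalIdeals_of_fg {M : Submodule (𝓞 K) (K × K)} (hM : M.FG)
    (h₁ : ((1, 0) : K × K) ∈ M) (h₂ : ((0, 1) : K × K) ∈ M) :
    ∃ (A B : FractionalIdeal (𝓞 K)⁰ K) (a : K), A ≠ 0 ∧ B ≠ 0 ∧
      ∀ x y, (x, y) ∈ M ↔ y ∈ B ∧ x - y * a ∈ A := by
  have : IsNoetherian (𝓞 K) M := isNoetherian_of_fg_of_noetherian M hM
  have hAfg : (M.comap (LinearMap.inl (𝓞 K) K K)).FG := by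
    refine Submodule.fg_of_fg_map_injective (LinearMap.inl (𝓞 K) K K) LinearMap.inl_injective ?_
    exact Submodule.FG.of_le hM (Submodule.map_comap_le _ _)
  let A : FractionalIdeal (𝓞 K)⁰ K := ⟨_, isFractional_of_fg hAfg⟩
  let B : FractionalIdeal (𝓞 K)⁰ K :=
    ⟨_, isFractional_of_fg (hM.map (LinearMap.snd (𝓞 K) K K))⟩
  have hA : ∀ {x}, x ∈ A ↔ (x, 0) ∈ M := Iff.rfl
  have hB : ∀ {y}, y ∈ B ↔ ∃ x, (x, y) ∈ M := fun {y} =>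
    ⟨fun ⟨⟨x, y'⟩, hv, h⟩ => ⟨x, by subst h; exact hv⟩, fun ⟨x, h⟩ => ⟨(x, y), h, rfl⟩⟩
  have hA0 : A ≠ 0 := fun h => one_ne_zero (α := K) (by
    rw [← mem_zero_iff (S := (𝓞 K)⁰), ← h]; exact h₁)
  have hB0 : B ≠ 0 := fun h => one_ne_zero (α := K) (by
    rw [← mem_zero_iff (S := (𝓞 K)⁰), ← h]; exact hB.2 ⟨0, h₂⟩)
  -- The projection onto `B` splits since `B` is invertible. For `t = b w`, lift `b` to `M` and
  -- multiply the lift by the integer `y w`; such lifts add up, and `t = 1` gives the splitting.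
  have split : ∀ t ∈ B * B⁻¹, ∃ a : K, ∀ y ∈ B, (y * a, y * t) ∈ M := by
    intro t ht
    refine FractionalIdeal.mul_induction_on ht (fun b hb w hw => ?_) ?_
    · obtain ⟨a, ha⟩ := hB.1 hb
      refine ⟨w * a, fun y hy => ?_⟩
      obtain ⟨r, hr⟩ := (mem_one_iff (𝓞 K)⁰).1 ((mem_inv_iff hB0).1 hw y hy)
      have := M.smul_mem r ha
      convert this using 1
      rw [Prod.smul_mk, Algebra.smul_def, Algebra.smul_def, hr]
      congr 1 <;> ring
    · rintro t t' ⟨a, ha⟩ ⟨a', ha'⟩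
      refine ⟨a + a', fun y hy => ?_⟩
      rw [mul_add, mul_add]
      exact M.add_mem (ha y hy) (ha' y hy)
  obtain ⟨a, ha⟩ := split 1 (by rw [mul_inv_cancel₀ hB0]; exact one_mem_one _)
  refine ⟨A, B, a, hA0, hB0, fun x y => ⟨fun h => ?_, fun h => ?_⟩⟩
  · have hy := hB.2 ⟨x, h⟩
    have := M.sub_mem h (ha y hy)
    rw [Prod.mk_sub_mk, mul_one, sub_self] at this
    exact ⟨hy, this⟩
  · have := M.add_mem (hA.1 h.2) (ha y h.1)
    rwa [Prod.mk_add_mk, mul_one, zero_add, sub_add_cancel] at this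

/-- Every lattice is a direct sum of two fractional ideals in suitable coordinates. -/
theorem IsOKLattice.exists_eq_map_oplus {L : Submodule (𝓞 K) (RowSpace K)} (hL : IsOKLattice L) :
    ∃ (A B : FractionalIdeal (𝓞 K)⁰ K) (U : GG K), A ≠ 0 ∧ B ≠ 0 ∧
      L = (oplus A B).map (rightMul U) := by
  have : Module.Finite K (Submodule.span K (L : Set (RowSpace K))) :=
    Module.finite_of_finrank_pos (by rw [hL.finrank_span]; exact two_pos)
  -- The two vectors come from `L` itself and span `K L` over `K`. They therefore span the row space
  -- over `KHat K`, which makes their matrix invertible.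
  have hf := Submodule.exists_fun_fin_finrank_span_eq K (L : Set (RowSpace K))
  rw [hL.finrank_span] at hf
  obtain ⟨f, hfL, hf, -⟩ := hf
  have hsurj : Function.Surjective fun v : RowSpace K => Matrix.vecMul v (Matrix.of f) := by
    intro w
    have hw : w ∈ Submodule.span (KHat K) (Set.range f) := by
      have : Submodule.span (KHat K) (L : Set (RowSpace K)) ≤
          Submodule.span (KHat K) (Set.range f) := by
        rw [Submodule.span_le]
        intro l hl
        have h1 : l ∈ Submodule.span K (Set.range f) := hf ▸ Submodule.subset_span hl
        exact Submodule.span_le_restrictScalars K (KHat K) _ h1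
      exact this (hL.span_eq_top ▸ Submodule.mem_top)
    obtain ⟨c, hc⟩ := (Submodule.mem_span_range_iff_exists_fun _).1 hw
    refine ⟨c, ?_⟩
    rw [← hc]
    exact Matrix.vecMul_eq_sum _ _
  obtain ⟨U, hU⟩ := Matrix.vecMul_surjective_iff_isUnit.1 hsurj
  have hUvec : ∀ x y : K, rightMul U (vec x y) = x • f 0 + y • f 1 := fun x y => by
    rw [rightMul_apply, hU, Matrix.vecMul_eq_sum, Fin.sum_univ_two, ← algebraMap_smul (KHat K) x,
      ← algebraMap_smul (KHat K) y]
    rfl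
  -- In the coordinates of this basis the lattice lies in `K²` and contains the standard basis.
  set L₀ := L.map (rightMul U⁻¹) with hL₀
  have hLL₀ : L = L₀.map (rightMul U) := by
    rw [hL₀, ← map_rightMul_mul, inv_mul_cancel, map_rightMul_one]
  have hmem : ∀ v, v ∈ L₀ ↔ rightMul U v ∈ L := fun v => by
    rw [hLL₀]
    exact ((rightMul_injective U).mem_set_image (s := (L₀ : Set (RowSpace K)))).symm
  have hrange : ∀ v ∈ L₀, ∃ x y : K, v = vec x y := by
    intro v hv
    have h1 : rightMul U v ∈ Submodule.span K (Set.range f) :=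
      hf ▸ Submodule.subset_span ((hmem v).1 hv)
    obtain ⟨c, hc⟩ := (Submodule.mem_span_range_iff_exists_fun _).1 h1
    refine ⟨c 0, c 1, rightMul_injective U ?_⟩
    rw [hUvec, ← hc, Fin.sum_univ_two]
  let M : Submodule (𝓞 K) (K × K) := L₀.comap ((vecLinear K).restrictScalars (𝓞 K))
  have hMmem : ∀ x y, (x, y) ∈ M ↔ vec x y ∈ L₀ := fun _ _ => Iff.rfl
  have hMfg : M.FG := by
    refine Submodule.fg_of_fg_map_injective ((vecLinear K).restrictScalars (𝓞 K))
      vecLinear_injective ?_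
    have : M.map ((vecLinear K).restrictScalars (𝓞 K)) = L₀ := by
      refine le_antisymm (Submodule.map_comap_le _ _) fun v hv => ?_
      obtain ⟨x, y, rfl⟩ := hrange v hv
      exact ⟨(x, y), hv, rfl⟩
    rw [this]
    exact hL.fg.map _
  obtain ⟨A, B, a, hA, hB, hAB⟩ := exists_fractionalIdeals_of_fg hMfg
    ((hMmem _ _).2 ((hmem _).2 (by simpa [hUvec] using hfL 0)))
    ((hMmem _ _).2 ((hmem _).2 (by simpa [hUvec] using hfL 1)))
  have hg : (1 : K) * 1 - 0 * a ≠ 0 := by simp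
  refine ⟨A, B, toGG (mkGL 1 0 a 1 hg) * U, hA, hB, ?_⟩
  rw [map_rightMul_mul]
  conv_lhs => rw [hLL₀]
  congr 1
  ext v
  rw [Submodule.mem_map]
  constructor
  · intro hv
    obtain ⟨x, y, rfl⟩ := hrange v hv
    obtain ⟨hy, hx⟩ := (hAB x y).1 hv
    refine ⟨vec (x - y * a) y, vec_mem_oplus.2 ⟨hx, hy⟩, ?_⟩
    rw [rightMul_toGG_vec]
    change vec ((x - y * a) * 1 + y * a) ((x - y * a) * 0 + y * 1) = _
    congr 1 <;> ring
  · rintro ⟨_, ⟨x, hx, y, hy, rfl⟩, rfl⟩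
    refine (rightMul_toGG_vec (mkGL 1 0 a 1 hg) x y).symm ▸ ?_
    change vec (x * 1 + y * a) (x * 0 + y * 1) ∈ L₀
    rw [← hMmem, hAB]
    constructor
    · simpa using hy
    · simpa using hx

/-- The quotient is generated by the class of `β`, so only its annihilator matters. In this form the
level condition is visibly preserved by the action. -/
theorem nonempty_quotient_equiv_iff {n : Ideal (𝓞 K)} {L : Submodule (𝓞 K) (RowSpace K)}
    {β : RowSpace K} :
    Nonempty (((L ⊔ Submodule.span (𝓞 K) {β} : Submodule (𝓞 K) (RowSpace K)) ⧸
      L.submoduleOf (L ⊔ Submodule.span (𝓞 K) {β})) ≃ₗ[𝓞 K] (𝓞 K ⧸ n)) ↔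
      ∀ r : 𝓞 K, r • β ∈ L ↔ r ∈ n := by
  set L' := L ⊔ Submodule.span (𝓞 K) {β} with hL'
  have hβ : β ∈ L' := Submodule.mem_sup_right (Submodule.mem_span_singleton_self β)
  have hmem : ∀ v ∈ L', ∃ l ∈ L, ∃ r : 𝓞 K, l + r • β = v := by
    intro v hv
    obtain ⟨l, hl, w, hw, rfl⟩ := Submodule.mem_sup.1 hv
    obtain ⟨r, rfl⟩ := Submodule.mem_span_singleton.1 hw
    exact ⟨l, hl, r, rfl⟩
  constructor
  · rintro ⟨e⟩ r
    have h := e.annihilator_eq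
    rw [Ideal.annihilator_quotient] at h
    rw [← h, Module.mem_annihilator]
    constructor
    · intro hr m
      obtain ⟨⟨v, hv⟩, rfl⟩ := Submodule.mkQ_surjective _ m
      obtain ⟨l, hl, s, rfl⟩ := hmem v hv
      rw [← map_smul, Submodule.mkQ_apply, Submodule.Quotient.mk_eq_zero]
      · change r • (l + s • β) ∈ L
        rw [smul_add, smul_comm]
        exact L.add_mem (L.smul_mem _ hl) (L.smul_mem _ hr)
    · intro hr
      have := hr (Submodule.mkQ _ ⟨β, hβ⟩)
      rw [← map_smul, Submodule.mkQ_apply, Submodule.Quotient.mk_eq_zero] at this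
      exact this
  · intro h
    let f : 𝓞 K →ₗ[𝓞 K] L' ⧸ L.submoduleOf L' :=
      (L.submoduleOf L').mkQ ∘ₗ LinearMap.toSpanSingleton (𝓞 K) L' ⟨β, hβ⟩
    have hf : ∀ r, f r = (L.submoduleOf L').mkQ (r • ⟨β, hβ⟩) := fun _ => rfl
    have hker : LinearMap.ker f = n := by
      ext r
      rw [LinearMap.mem_ker, hf, Submodule.mkQ_apply, Submodule.Quotient.mk_eq_zero, ← h]
      exact Iff.rfl
    have hsurj : Function.Surjective f := by
      intro m
      obtain ⟨⟨v, hv⟩, rfl⟩ := Submodule.mkQ_surjective _ m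
      obtain ⟨l, hl, s, rfl⟩ := hmem v hv
      refine ⟨s, ?_⟩
      rw [hf, ← sub_eq_zero, ← map_sub, Submodule.mkQ_apply, Submodule.Quotient.mk_eq_zero]
      change s • β - (l + s • β) ∈ L
      rw [sub_add_cancel_right]
      exact L.neg_mem hl
    exact ⟨((Submodule.quotEquivOfEq _ _ hker).symm.trans
      (f.quotKerEquivOfSurjective hsurj)).symm⟩

end Lattices

/-! ### Normal form of a lattice with a level structure. -/

section LevelStructure

variable {K : Type*} [Field K] [NumberField K]

/-- The element `w` generates `D n⁻¹` modulo `D`, and that quotient has annihilator `n`. -/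
theorem mul_mem_iff_of_generates {n : (Ideal (𝓞 K))⁰} {D : FractionalIdeal (𝓞 K)⁰ K}
    (hD : D ≠ 0) {w : K} (hw : D * (frac n)⁻¹ = D + spanSingleton (𝓞 K)⁰ w) {r : K}
    (hr : r ∈ (1 : FractionalIdeal (𝓞 K)⁰ K)) : r * w ∈ D ↔ r ∈ frac n := by
  have hn := frac_ne_zero n
  have hwm : w ∈ D * (frac n)⁻¹ := by
    rw [hw, ← spanSingleton_le_iff_mem]
    exact le_add_self
  constructor
  · intro h
    have h1 : spanSingleton (𝓞 K)⁰ r * (D * (frac n)⁻¹) ≤ D := by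
      rw [hw, mul_add, add_le_iff, spanSingleton_mul_spanSingleton, spanSingleton_le_iff_mem,
        spanSingleton_mul_le_iff]
      exact ⟨fun d hd => frac_one_mul hr hd, h⟩
    rw [← spanSingleton_le_iff_mem]
    calc spanSingleton (𝓞 K)⁰ r = spanSingleton (𝓞 K)⁰ r * (D * (frac n)⁻¹) * D⁻¹ * frac n := by
          field_simp
      _ ≤ D * D⁻¹ * frac n := by gcongr
      _ = frac n := by field_simp
  · intro h
    have := mul_mem_mul h hwm
    rwa [mul_comm D, mul_inv_cancel_left₀ hn] at this

/-- The inverse of the right-hand side consists of the integers `r` with `r x` in `A` and `r y` in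
`B`, which is `n` by hypothesis. -/
theorem inv_level_eq {A B : FractionalIdeal (𝓞 K)⁰ K} (hA : A ≠ 0) (hB : B ≠ 0)
    {n : (Ideal (𝓞 K))⁰} {x y : K}
    (h : ∀ r : 𝓞 K, ((r : K) * x ∈ A ∧ (r : K) * y ∈ B) ↔ r ∈ (n : Ideal (𝓞 K))) :
    (frac n)⁻¹ = 1 + spanSingleton (𝓞 K)⁰ x * A⁻¹ + spanSingleton (𝓞 K)⁰ y * B⁻¹ := by
  have hn := frac_ne_zero n
  set W := 1 + spanSingleton (𝓞 K)⁰ x * A⁻¹ + spanSingleton (𝓞 K)⁰ y * B⁻¹ with hW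
  have h1W : 1 ≤ W := by
    rw [hW, add_assoc]
    exact le_self_add
  have hxW : spanSingleton (𝓞 K)⁰ x * A⁻¹ ≤ W := by
    rw [hW, add_right_comm]
    exact le_add_self
  have hyW : spanSingleton (𝓞 K)⁰ y * B⁻¹ ≤ W := le_add_self
  have hW0 : W ≠ 0 := fun h0 => 
    one_ne_zero (α := FractionalIdeal (𝓞 K)⁰ K) (le_antisymm (h1W.trans h0.le) (zero_le _))
  have mul_le : ∀ {I : FractionalIdeal (𝓞 K)⁰ K} {v : K}, I ≠ 0 →
      (∀ r : 𝓞 K, r ∈ (n : Ideal (𝓞 K)) → (r : K) * v ∈ I) →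
      spanSingleton (𝓞 K)⁰ v * I⁻¹ ≤ (frac n)⁻¹ := by
    intro I v hI hv
    have h1 : spanSingleton (𝓞 K)⁰ v * frac n ≤ I := by
      rw [spanSingleton_mul_le_iff]
      intro s hs
      obtain ⟨r, hr, rfl⟩ := (mem_coeIdeal _).1 hs
      rw [mul_comm]
      exact hv r hr
    calc spanSingleton (𝓞 K)⁰ v * I⁻¹ = spanSingleton (𝓞 K)⁰ v * frac n * I⁻¹ * (frac n)⁻¹ := by
          field_simp
      _ ≤ I * I⁻¹ * (frac n)⁻¹ := by gcongr
      _ = (frac n)⁻¹ := by field_simp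
  apply le_antisymm
  · have hle : W⁻¹ ≤ frac n := by
      intro r hr
      have hrW := (mem_inv_iff hW0).1 hr
      obtain ⟨s, rfl⟩ := (mem_one_iff (𝓞 K)⁰).1
        (mul_one r ▸ hrW 1 (h1W (one_mem_one _)))
      refine (mem_coeIdeal _).2 ⟨s, (h s).1 ?_, rfl⟩
      have key : ∀ {I : FractionalIdeal (𝓞 K)⁰ K} {v : K}, I ≠ 0 →
          spanSingleton (𝓞 K)⁰ v * I⁻¹ ≤ W → algebraMap (𝓞 K) K s * v ∈ I := by
        intro I v hI hv
        rw [← spanSingleton_le_iff_mem, ← spanSingleton_mul_spanSingleton]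
        calc _ = spanSingleton (𝓞 K)⁰ (algebraMap (𝓞 K) K s) *
                (spanSingleton (𝓞 K)⁰ v * I⁻¹) * I := by field_simp
          _ ≤ W⁻¹ * W * I := by
              gcongr
              exact spanSingleton_le_iff_mem.2 hr
          _ = I := by field_simp
      exact ⟨key hA hxW, key hB hyW⟩
    simpa using inv_anti_mono (inv_ne_zero hW0) hn hle
  · rw [hW, add_le_iff, add_le_iff]
    refine ⟨⟨?_, mul_le hA fun r hr => ((h r).2 hr).1⟩, mul_le hB fun r hr => ((h r).2 hr).2⟩
    have := inv_anti_mono hn one_ne_zero (coeIdeal_le_one : frac n ≤ 1)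
    rwa [inv_one] at this

/-- These shears adjust the first coordinate of the level vector without moving `C ⊕ D`. -/
theorem map_shear_oplus {C D : FractionalIdeal (𝓞 K)⁰ K} (hD : D ≠ 0) {κ : K}
    (hκ : κ ∈ C * D⁻¹) (h : (1 : K) * 1 - 0 * κ ≠ 0) :
    (oplus C D).map (rightMul (toGG (mkGL 1 0 κ 1 h))) = oplus C D := by
  have key : ∀ {κ : K}, κ ∈ C * D⁻¹ → ∀ h, (oplus C D).map (rightMul (toGG (mkGL 1 0 κ 1 h))) ≤
      oplus C D := by
    intro κ hκ h
    rw [map_oplus_le_iff]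
    refine ⟨fun x hx => ?_, fun x _ => ?_, (mem_mul_inv_iff hD).1 hκ, fun y hy => ?_⟩
    · change x * 1 ∈ _
      rwa [mul_one]
    · change x * 0 ∈ _
      rw [mul_zero]
      exact FractionalIdeal.zero_mem _
    · change y * 1 ∈ _
      rwa [mul_one]
  refine map_oplus_eq (key hκ h) ?_
  rw [mkGL_inv_of_det_one _ _ _ _ (by ring) _ (by ring_nf; exact one_ne_zero)]
  have e : mkGL 1 (-0 : K) (-κ) 1 (by ring_nf; exact one_ne_zero) =
      mkGL 1 0 (-κ) 1 (by ring_nf; exact one_ne_zero) := by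
    congr 1
    exact neg_zero
  rw [e]
  exact key (frac_neg hκ) _

/-- Normal form of a direct sum of two fractional ideals together with a vector generating a
cyclic extension with annihilator `n`. -/
theorem exists_map_oplus_eq_and_vec {A B C D : FractionalIdeal (𝓞 K)⁰ K} (hA : A ≠ 0)
    (hB : B ≠ 0) (hC : C ≠ 0) (hD : D ≠ 0) (hABCD : A * B = C * D) {n : (Ideal (𝓞 K))⁰}
    {w : K} (hw : D * (frac n)⁻¹ = D + spanSingleton (𝓞 K)⁰ w) {x y : K}
    (h : ∀ r : 𝓞 K, ((r : K) * x ∈ A ∧ (r : K) * y ∈ B) ↔ r ∈ (n : Ideal (𝓞 K))) :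
    ∃ g : GL (Fin 2) K, (oplus A B).map (rightMul (toGG g)) = oplus C D ∧
      rightMul (toGG g) (vec x y) - vec 0 w ∈ oplus C D := by
  have hn := frac_ne_zero n
  have hN := inv_level_eq hA hB h
  have hxA : x ∈ A * (frac n)⁻¹ := by
    rw [← spanSingleton_le_iff_mem, hN]
    calc spanSingleton (𝓞 K)⁰ x = A * (spanSingleton (𝓞 K)⁰ x * A⁻¹) := by field_simp
      _ ≤ _ := by
        gcongr
        rw [add_right_comm]
        exact le_add_self
  have hyB : y ∈ B * (frac n)⁻¹ := by
    rw [← spanSingleton_le_iff_mem, hN]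
    calc spanSingleton (𝓞 K)⁰ y = B * (spanSingleton (𝓞 K)⁰ y * B⁻¹) := by field_simp
      _ ≤ _ := by
        gcongr
        exact le_add_self
  -- Multiplying `inv_level_eq` by `D` gives `w = d + x u + y v`; the pair `(u, v)` is a first
  -- approximation to the second column.
  have hwm : w ∈ D + spanSingleton (𝓞 K)⁰ x * (D * A⁻¹) + spanSingleton (𝓞 K)⁰ y * (D * B⁻¹) := by
    have : D * (frac n)⁻¹ =
        D + spanSingleton (𝓞 K)⁰ x * (D * A⁻¹) + spanSingleton (𝓞 K)⁰ y * (D * B⁻¹) := by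
      rw [hN]; ring
    rw [← this, hw, ← spanSingleton_le_iff_mem]
    exact le_add_self
  obtain ⟨e, he, yv, hyv, rfl⟩ := mem_add_iff.1 hwm
  obtain ⟨d, hd, xu, hxu, rfl⟩ := mem_add_iff.1 he
  obtain ⟨u, hu, rfl⟩ := mem_singleton_mul.1 hxu
  obtain ⟨v, hv, rfl⟩ := mem_singleton_mul.1 hyv
  set w := d + x * u + y * v with hwdef
  -- The left side times `n⁻¹` contains `D` and `x u + y v`, hence `w`, hence all of `D n⁻¹`.
  have hgen : spanSingleton (𝓞 K)⁰ u * A + spanSingleton (𝓞 K)⁰ v * B + D * frac n = D := by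
    apply le_antisymm
    · rw [add_le_iff, add_le_iff]
      refine ⟨⟨?_, ?_⟩, mul_coeIdeal_le D _⟩
      · calc _ ≤ D * A⁻¹ * A := by gcongr; exact spanSingleton_le_iff_mem.2 hu
          _ = D := inv_mul_cancel_right₀ hA D
      · calc _ ≤ D * B⁻¹ * B := by gcongr; exact spanSingleton_le_iff_mem.2 hv
          _ = D := inv_mul_cancel_right₀ hB D
    · set W := spanSingleton (𝓞 K)⁰ u * A + spanSingleton (𝓞 K)⁰ v * B + D * frac n with hW
      have hexp : W * (frac n)⁻¹ = spanSingleton (𝓞 K)⁰ u * (A * (frac n)⁻¹) +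
          spanSingleton (𝓞 K)⁰ v * (B * (frac n)⁻¹) + D := by
        rw [hW, add_mul, add_mul, mul_inv_cancel_right₀ hn, mul_assoc, mul_assoc]
      have hle : D * (frac n)⁻¹ ≤ W * (frac n)⁻¹ := by
        rw [hw, add_le_iff, hexp, spanSingleton_le_iff_mem]
        refine ⟨le_add_self, mem_add_iff.2 ⟨_, mem_add_iff.2 ⟨_, mul_mem_mul
          (mem_spanSingleton_self _ _) hxA, _, mul_mem_mul (mem_spanSingleton_self _ _) hyB,
          rfl⟩, d, hd, ?_⟩⟩
        rw [hwdef]; ring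
      calc D = D * (frac n)⁻¹ * frac n := by field_simp
        _ ≤ W * (frac n)⁻¹ * frac n := by gcongr
        _ = W := by field_simp
  obtain ⟨δ, hδ, ε, hε, huv⟩ := exists_unimodular hA hB hD
    (nonZeroDivisors.coe_ne_zero n) hgen
  obtain ⟨g, hg1, hg2, hg⟩ := exists_map_oplus_eq_of_column hA hB hD hABCD huv
  -- The factor `n` in `δ` and `ε` absorbs the denominators of `x` and `y`, so the congruence modulo
  -- `D` survives the correction.
  have hs : x * (u + δ) + y * (v + ε) - w ∈ D := by
    have h1 := mul_mem_mul hxA hδ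
    have h2 := mul_mem_mul hyB hε
    rw [show A * (frac n)⁻¹ * (D * A⁻¹ * frac n) = D by field_simp] at h1
    rw [show B * (frac n)⁻¹ * (D * B⁻¹ * frac n) = D by field_simp] at h2
    have := frac_add (frac_add h1 h2) (frac_neg hd)
    convert this using 1
    rw [hwdef]; ring
  obtain ⟨h00, -, h10, -⟩ := map_oplus_le_iff.1 hg.le
  -- The first coordinate lies in `C n⁻¹ = C + w C D⁻¹`, so it is `κ w` modulo `C`. As the second
  -- coordinate is `w` modulo `D`, subtracting `κ` times it leaves an element of `C`.
  have hf : x * g 0 0 + y * g 1 0 ∈ C + spanSingleton (𝓞 K)⁰ w * (C * D⁻¹) := by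
    have h1 := mul_mem_mul hxA ((mem_mul_inv_iff hA).2 h00)
    have h2 := mul_mem_mul hyB ((mem_mul_inv_iff hB).2 h10)
    rw [show A * (frac n)⁻¹ * (C * A⁻¹) = C * D⁻¹ * (D * (frac n)⁻¹) by field_simp] at h1
    rw [show B * (frac n)⁻¹ * (C * B⁻¹) = C * D⁻¹ * (D * (frac n)⁻¹) by field_simp] at h2
    have := frac_add h1 h2
    rwa [hw, mul_add, inv_mul_cancel_right₀ hD, mul_comm _ (spanSingleton _ _)] at this
  obtain ⟨c, hc, wk, hwk, hcw⟩ := mem_add_iff.1 hf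
  obtain ⟨κ, hκ, rfl⟩ := mem_singleton_mul.1 hwk
  have hdet : (1 : K) * 1 - 0 * -κ ≠ 0 := by simp
  refine ⟨g * mkGL 1 0 (-κ) 1 hdet, ?_, ?_⟩
  · rw [map_mul, map_rightMul_mul, hg, map_shear_oplus hD (frac_neg hκ)]
  · rw [map_mul, rightMul_mul, rightMul_toGG_vec, rightMul_toGG_vec, vec_sub, vec_mem_oplus,
      hg1, hg2]
    change (x * g 0 0 + y * g 1 0) * 1 + (x * (u + δ) + y * (v + ε)) * -κ - 0 ∈ C ∧
      (x * g 0 0 + y * g 1 0) * 0 + (x * (u + δ) + y * (v + ε)) * 1 - w ∈ D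
    constructor
    · have h1 := mul_mem_mul hκ hs
      rw [inv_mul_cancel_right₀ hD] at h1
      have := frac_add hc (frac_neg h1)
      convert this using 1
      rw [← hcw]; ring
    · convert hs using 1
      ring

end LevelStructure

/-! ### The action on triples, and rationality of matrices between lattices. -/

section Action

variable {K : Type*} [Field K] [NumberField K]

theorem mkTriple_eq_iff {L₁ L₁' L₂ L₂' : Submodule (𝓞 K) (RowSpace K)} {β₁ β₂ : RowSpace K} :
    mkTriple L₁ L₁' β₁ = mkTriple L₂ L₂' β₂ ↔ L₁ = L₂ ∧ L₁' = L₂' ∧ β₁ - β₂ ∈ L₁ :=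
  Quotient.eq

theorem mkTriple_act (L L' : Submodule (𝓞 K) (RowSpace K)) (β : RowSpace K) (U : GG K) :
    (mkTriple L L' β).act U = mkTriple (L.map (rightMul U)) (L'.map (rightMul U)) (rightMul U β) :=
  rfl

theorem Triple.act_mul (P : Triple K) (U V : GG K) : P.act (U * V) = (P.act U).act V := by
  induction P using Quotient.inductionOn with
  | h t =>
    change mkTriple _ _ _ = mkTriple _ _ _
    rw [map_rightMul_mul, map_rightMul_mul, rightMul_mul]

theorem Triple.act_one (P : Triple K) : P.act 1 = P := by
  induction P using Quotient.inductionOn with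
  | h t =>
    change mkTriple _ _ _ = mkTriple t.L t.L' t.β
    rw [map_rightMul_one, map_rightMul_one, rightMul_one]

theorem Triple.act_eq_iff {P Q : Triple K} {U : GG K} : P.act U = Q ↔ P = Q.act U⁻¹ := by
  constructor
  · rintro rfl
    rw [← Triple.act_mul, mul_inv_cancel, Triple.act_one]
  · rintro rfl
    rw [← Triple.act_mul, inv_mul_cancel, Triple.act_one]

theorem Triple.pair_act (P : Triple K) (U : GG K) :
    (P.act U).pair = (P.pair.1.map (rightMul U), P.pair.2.map (rightMul U)) := by
  induction P using Quotient.inductionOn with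
  | h t => rfl

theorem act_mem_M₁ {n : (Ideal (𝓞 K))⁰} {P : Triple K} (hP : P ∈ M₁ n) (U : GG K) :
    P.act U ∈ M₁ n := by
  obtain ⟨L, L', β, ⟨hL, hL', hle, hq⟩, hβ, rfl, rfl⟩ := hP
  rw [nonempty_quotient_equiv_iff] at hq
  have hmap : (L ⊔ Submodule.span (𝓞 K) {β}).map (rightMul U) =
      L.map (rightMul U) ⊔ Submodule.span (𝓞 K) {rightMul U β} := by
    rw [Submodule.map_sup, Submodule.map_span, Set.image_singleton]
  refine ⟨L.map (rightMul U), L.map (rightMul U) ⊔ Submodule.span (𝓞 K) {rightMul U β},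
    rightMul U β, ⟨hL.map U, hmap ▸ hL'.map U, le_sup_left, ?_⟩,
    Submodule.mem_sup_right (Submodule.mem_span_singleton_self _), rfl, ?_⟩
  · rw [nonempty_quotient_equiv_iff]
    intro r
    rw [← hq, ← map_smul]
    exact (rightMul_injective U).mem_set_image (s := (L : Set (RowSpace K)))
  · rw [mkTriple_act, hmap]

theorem act_mem_M₁Class {n : (Ideal (𝓞 K))⁰} {c : ClassGroup (𝓞 K)} {P : Triple K}
    (hP : P ∈ M₁Class n c) (U : GG K) : P.act U ∈ M₁Class n c := by
  refine ⟨act_mem_M₁ hP.1 U, ?_⟩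
  rw [Triple.pair_act, hasClass_map_iff]
  exact hP.2

theorem IsOKLattice.existsUnique_hasClass {L : Submodule (𝓞 K) (RowSpace K)}
    (hL : IsOKLattice L) : ∃! c, HasClass L c := by
  obtain ⟨A, B, U, hA, hB, rfl⟩ := hL.exists_eq_map_oplus
  simp only [hasClass_map_iff]
  obtain ⟨a, I, ha, hI⟩ := exists_eq_spanSingleton_mul (A * B)
  have ha' : algebraMap (𝓞 K) K a ≠ 0 := by simpa using ha
  have hI' : spanSingleton (𝓞 K)⁰ (algebraMap (𝓞 K) K a) * (A * B) = I := by
    rw [hI, ← mul_assoc, spanSingleton_mul_spanSingleton, mul_inv_cancel₀ ha', spanSingleton_one,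
      one_mul]
  have hI0 : I ∈ (Ideal (𝓞 K))⁰ := by
    rw [mem_nonZeroDivisors_iff_ne_zero]
    rintro rfl
    exact mul_ne_zero hA hB (by rw [hI, Submodule.zero_eq_bot, coeIdeal_bot, mul_zero])
  refine ⟨ClassGroup.mk0 ⟨I, hI0⟩, (hasClass_oplus_iff hA hB _).2 ⟨_, ha', hI'⟩, fun c hc => ?_⟩
  obtain ⟨J, rfl⟩ := ClassGroup.mk0_surjective c
  obtain ⟨t, ht, hJ⟩ := (hasClass_oplus_iff hA hB _).1 hc
  refine (ClassGroup.mk0_eq_mk0_iff_exists_fraction_ring K).2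
    ⟨algebraMap (𝓞 K) K a * t⁻¹, mul_ne_zero ha' (inv_ne_zero ht), ?_⟩
  change _ * frac J = _
  rw [← hJ, ← mul_assoc, spanSingleton_mul_spanSingleton, inv_mul_cancel_right₀ ht]
  exact hI'

/-- A matrix over `KHat K` mapping one direct sum of fractional ideals to another has entries
in `K`. -/
theorem exists_eq_toGG {A B C D : FractionalIdeal (𝓞 K)⁰ K} (hA : A ≠ 0) (hB : B ≠ 0) {W : GG K}
    (h : (oplus A B).map (rightMul W) = oplus C D) : ∃ g : GL (Fin 2) K, W = toGG g := by
  obtain ⟨a, ha, ha0⟩ := exists_mem_ne_zero hA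
  obtain ⟨b, hb, hb0⟩ := exists_mem_ne_zero hB
  have entry : ∀ x y : K, vec x y ∈ oplus A B → ∃ s t : K, rightMul W (vec x y) = vec s t := by
    intro x y hxy
    have : rightMul W (vec x y) ∈ oplus C D := h ▸ Submodule.mem_map_of_mem hxy
    obtain ⟨s, -, t, -, hst⟩ := this
    exact ⟨s, t, hst⟩
  have cancel : ∀ {x s : K} {w : KHat K}, x ≠ 0 →
      algebraMap K (KHat K) x * w = algebraMap K (KHat K) s →
      w = algebraMap K (KHat K) (x⁻¹ * s) := by
    intro x s w hx hw
    rw [map_mul, ← hw, ← mul_assoc, ← map_mul, inv_mul_cancel₀ hx, map_one, one_mul]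
  have apply : ∀ (x y : K) (i : Fin 2), rightMul W (vec x y) i =
      algebraMap K (KHat K) x * W 0 i + algebraMap K (KHat K) y * W 1 i := by
    intro x y i
    rw [rightMul_apply, Matrix.vecMul, dotProduct, Fin.sum_univ_two]
    rfl
  -- A nonzero lattice vector on each axis determines a row of `W` up to a scalar from `K`.
  obtain ⟨s, t, hst⟩ := entry a 0 (vec_mem_oplus.2 ⟨ha, B.zero_mem⟩)
  obtain ⟨s', t', hst'⟩ := entry 0 b (vec_mem_oplus.2 ⟨A.zero_mem, hb⟩)
  have e00 := congrFun hst 0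
  have e01 := congrFun hst 1
  have e10 := congrFun hst' 0
  have e11 := congrFun hst' 1
  rw [apply, map_zero, zero_mul] at e00 e01 e10 e11
  rw [add_zero] at e00 e01
  rw [zero_add] at e10 e11
  have f00 := cancel ha0 e00
  have f01 := cancel ha0 e01
  have f10 := cancel hb0 e10
  have f11 := cancel hb0 e11
  have hWdet : IsUnit (W : Matrix (Fin 2) (Fin 2) (KHat K)).det :=
    (Matrix.isUnit_iff_isUnit_det _).1 W.isUnit
  rw [Matrix.det_fin_two, f00, f01, f10, f11, ← map_mul, ← map_mul, ← map_sub] at hWdet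
  have hdet : a⁻¹ * s * (b⁻¹ * t') - a⁻¹ * t * (b⁻¹ * s') ≠ 0 := fun h0 => by
    rw [h0, map_zero] at hWdet
    exact not_isUnit_zero hWdet
  refine ⟨mkGL _ _ _ _ hdet, ?_⟩
  ext i j
  fin_cases i <;> fin_cases j
  · exact f00
  · exact f01
  · exact f10
  · exact f11

end Action

/-! ### The stabilizer of a pair of lattices. -/

section Stabilizers

variable {K : Type*} [Field K] [NumberField K]

theorem map_oplus_le_of_mem_gamma₀ {n p q : (Ideal (𝓞 K))⁰} {g : GL (Fin 2) K}
    (hg : g ∈ gamma₀ n p) :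
    (oplus (frac p * frac q) (frac q)).map (rightMul (toGG g)) ≤ oplus (frac p * frac q) (frac q) ∧
    (oplus (frac p * frac q) (frac q * (frac n)⁻¹)).map (rightMul (toGG g)) ≤
      oplus (frac p * frac q) (frac q * (frac n)⁻¹) := by
  have hn := frac_ne_zero n
  have hp := frac_ne_zero p
  obtain ⟨h00, h01, h10, h11, -⟩ := hg
  have hq_le : frac q ≤ frac q * (frac n)⁻¹ := by
    calc frac q = frac q * frac n * (frac n)⁻¹ := by field_simp
      _ ≤ frac q * (frac n)⁻¹ := by
        gcongr
        exact mul_coeIdeal_le _ _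
  have e01 : ∀ x ∈ frac p * frac q, x * g 0 1 ∈ frac q := fun x hx => by
    have := mul_mem_mul hx h01
    rwa [mul_comm (frac p), mul_inv_cancel_right₀ hp] at this
  have e10 : ∀ y ∈ frac q * (frac n)⁻¹, y * g 1 0 ∈ frac p * frac q := fun y hy => by
    have := mul_mem_mul hy h10
    rwa [mul_assoc, inv_mul_cancel_left₀ hn, mul_comm] at this
  rw [map_oplus_le_iff, map_oplus_le_iff]
  exact ⟨⟨fun x hx => frac_mul_one hx h00, e01, fun y hy => e10 y (hq_le hy),
      fun y hy => frac_mul_one hy h11⟩,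
    ⟨fun x hx => frac_mul_one hx h00, fun x hx => hq_le (e01 x hx), e10,
      fun y hy => frac_mul_one hy h11⟩⟩

/-- Each entry condition is an ideal quotient in which `q` cancels, so the group depends only on `n`
and `p`. The factor `n` in the lower left entry comes from the larger lattice, where `q n⁻¹` must go
into `p q`. -/
theorem mem_gamma₀_iff {n p q : (Ideal (𝓞 K))⁰} {g : GL (Fin 2) K} :
    g ∈ gamma₀ n p ↔
      (oplus (frac p * frac q) (frac q)).map (rightMul (toGG g)) =
        oplus (frac p * frac q) (frac q) ∧
      (oplus (frac p * frac q) (frac q * (frac n)⁻¹)).map (rightMul (toGG g)) =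
        oplus (frac p * frac q) (frac q * (frac n)⁻¹) := by
  have hn := frac_ne_zero n
  have hp := frac_ne_zero p
  have hq := frac_ne_zero q
  have hpq : frac p * frac q ≠ 0 := mul_ne_zero hp hq
  constructor
  · intro hg
    have h1 := map_oplus_le_of_mem_gamma₀ (q := q) hg
    have h2 := map_oplus_le_of_mem_gamma₀ (q := q) (inv_mem hg)
    exact ⟨map_oplus_eq h1.1 h2.1, map_oplus_eq h1.2 h2.2⟩
  · rintro ⟨h1, h2⟩
    -- The determinant multiplies `p q q` into itself, so it is integral; the same for `g⁻¹` makes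
    -- it a unit.
    have det_mem : ∀ {g : GL (Fin 2) K}, (oplus (frac p * frac q) (frac q)).map
        (rightMul (toGG g)) = oplus (frac p * frac q) (frac q) →
        ∃ r : 𝓞 K, (g : Matrix (Fin 2) (Fin 2) K).det = (r : K) := by
      intro g hg
      obtain ⟨h00, h01, h10, h11⟩ := map_oplus_le_iff.1 hg.le
      have hle := spanSingleton_det_mul_le h00 h01 h10 h11
      rw [← Matrix.det_fin_two] at hle
      have h0 : frac p * frac q * frac q ≠ 0 := mul_ne_zero hpq hq
      have : spanSingleton (𝓞 K)⁰ (g : Matrix (Fin 2) (Fin 2) K).det ≤ 1 := by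
        calc _ = spanSingleton (𝓞 K)⁰ (g : Matrix (Fin 2) (Fin 2) K).det *
              (frac p * frac q * frac q) * (frac p * frac q * frac q)⁻¹ :=
              (mul_inv_cancel_right₀ h0 _).symm
          _ ≤ (frac p * frac q * frac q) * (frac p * frac q * frac q)⁻¹ := by gcongr
          _ = 1 := mul_inv_cancel₀ h0
      obtain ⟨r, hr⟩ := (mem_one_iff _).1 (spanSingleton_le_iff_mem.1 this)
      exact ⟨r, hr.symm⟩
    obtain ⟨r, hr⟩ := det_mem h1
    obtain ⟨s, hs⟩ := det_mem (g := g⁻¹) (by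
      rw [map_inv, ← map_rightMul_eq_iff.1 h1])
    have hrs : r * s = 1 := by
      apply FaithfulSMul.algebraMap_injective (𝓞 K) K
      rw [map_mul, map_one]
      change (r : K) * (s : K) = 1
      rw [← hr, ← hs, ← Matrix.det_mul, ← Units.val_mul, mul_inv_cancel,
        Units.val_one, Matrix.det_one]
    obtain ⟨h00, h01, -, h11⟩ := map_oplus_le_iff.1 h1.le
    obtain ⟨-, -, h10, -⟩ := map_oplus_le_iff.1 h2.le
    rw [← mem_mul_inv_iff hpq] at h00 h01
    rw [← mem_mul_inv_iff hq] at h11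
    rw [← mem_mul_inv_iff (mul_ne_zero hq (inv_ne_zero hn))] at h10
    refine ⟨?_, ?_, ?_, ?_, ⟨r, s, hrs, by rw [mul_comm, hrs]⟩, hr⟩
    · rwa [mul_inv_cancel₀ hpq] at h00
    · rwa [show frac q * (frac p * frac q)⁻¹ = (frac p)⁻¹ by field_simp] at h01
    · rwa [show frac p * frac q * (frac q * (frac n)⁻¹)⁻¹ = frac n * frac p by
        field_simp] at h10
    · rwa [mul_inv_cancel₀ hq] at h11

end Stabilizers

/-! ### Standard points: level, class, orbits and stabilizers. -/

section StandardPoints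

variable {K : Type*} [Field K] [NumberField K] {n : (Ideal (𝓞 K))⁰} (D : Choices n)

namespace Choices

/-- Coprimality of `a_j` and `n` makes `z_j` a generator of `q_j` modulo `n q_j`. Since `n₀ n` is
integral, `n₀ q_j` is generated by `n₀ z_j` modulo `q_j`. -/
theorem generates (j : Fin (Nat.card (squares K))) :
    frac (D.q j) * (frac n)⁻¹ =
      frac (D.q j) + spanSingleton (𝓞 K)⁰ (D.n₀ * (D.z j : K)) := by
  have hn := frac_ne_zero n
  have hz : frac (D.a j) * frac (D.q j) = spanSingleton (𝓞 K)⁰ (D.z j : K) := by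
    rw [← coeIdeal_mul, D.a_mul_q, coeIdeal_span_singleton]
  have han : frac (D.a j) + frac n = 1 := by
    change ((D.a j : Ideal (𝓞 K)) : FractionalIdeal (𝓞 K)⁰ K) + ((n : Ideal (𝓞 K)) : _) = 1
    rw [← coeIdeal_sup, Ideal.isCoprime_iff_sup_eq.1 (D.a_coprime j), coeIdeal_top]
  have hq : frac (D.q j) = spanSingleton (𝓞 K)⁰ (D.z j : K) + frac n * frac (D.q j) := by
    rw [← hz, ← add_mul, han, one_mul]
  have hn₀ : spanSingleton (𝓞 K)⁰ D.n₀ ≤ (frac n)⁻¹ := by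
    rw [D.n₀_gen]
    exact le_add_self
  apply le_antisymm
  · rw [D.n₀_gen, spanSingleton_one, mul_add, mul_one, add_le_iff]
    refine ⟨le_self_add, ?_⟩
    calc frac (D.q j) * spanSingleton (𝓞 K)⁰ D.n₀ =
        spanSingleton (𝓞 K)⁰ (D.n₀ * (D.z j : K)) +
          frac (D.q j) * (spanSingleton (𝓞 K)⁰ D.n₀ * frac n) := by
          rw [← spanSingleton_mul_spanSingleton]
          conv_lhs => rw [hq]
          ring
      _ ≤ spanSingleton (𝓞 K)⁰ (D.n₀ * (D.z j : K)) + frac (D.q j) * ((frac n)⁻¹ * frac n) := by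
          gcongr
      _ = _ := by rw [inv_mul_cancel₀ hn, mul_one, add_comm]
  · rw [add_le_iff]
    constructor
    · calc frac (D.q j) = frac (D.q j) * 1 := (mul_one _).symm
        _ ≤ _ := by
          gcongr
          rw [D.n₀_gen, spanSingleton_one]
          exact le_self_add
    · rw [← spanSingleton_mul_spanSingleton, mul_comm]
      gcongr
      rw [hq]
      exact le_self_add

end Choices

theorem oplus_sup_span {A B : FractionalIdeal (𝓞 K)⁰ K} {w : K} :
    oplus A B ⊔ Submodule.span (𝓞 K) {vec 0 w} = oplus A (B + spanSingleton (𝓞 K)⁰ w) := by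
  apply le_antisymm
  · refine sup_le (oplus_mono le_rfl le_self_add) ?_
    rw [Submodule.span_singleton_le_iff_mem, vec_mem_oplus, ← spanSingleton_le_iff_mem (x := w)]
    exact ⟨A.zero_mem, le_add_self⟩
  · rintro _ ⟨x, hx, v, hv, rfl⟩
    obtain ⟨y, hy, _, hz, rfl⟩ := mem_add_iff.1 hv
    obtain ⟨r, rfl⟩ := (mem_spanSingleton _).1 hz
    refine Submodule.mem_sup.2 ⟨vec x y, vec_mem_oplus.2 ⟨hx, hy⟩, r • vec 0 w,
      Submodule.smul_mem _ _ (Submodule.mem_span_singleton_self _), ?_⟩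
    rw [integer_smul_vec, vec_add, mul_zero, add_zero, Algebra.smul_def]
    rfl

namespace Choices

theorem stdPoint_eq (i : Fin (squares K).index) (j : Fin (Nat.card (squares K))) :
    D.stdPoint i j = mkTriple (oplus (frac (D.p i) * frac (D.q j)) (frac (D.q j)))
      (oplus (frac (D.p i) * frac (D.q j)) (frac (D.q j)) ⊔
        Submodule.span (𝓞 K) {vec 0 (D.n₀ * (D.z j : K))})
      (vec 0 (D.n₀ * (D.z j : K))) := by
  rw [oplus_sup_span, ← D.generates, stdPoint, vec, map_zero]

theorem c_eq (i : Fin (squares K).index) (j : Fin (Nat.card (squares K))) :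
    D.c i j = ClassGroup.mk0 (D.p i * D.q j ^ 2) := by
  rw [c, map_mul, map_pow]

theorem frac_c (i : Fin (squares K).index) (j : Fin (Nat.card (squares K))) :
    frac (D.p i * D.q j ^ 2) = frac (D.p i) * frac (D.q j) * frac (D.q j) := by
  rw [frac, Submonoid.coe_mul, SubmonoidClass.coe_pow, coeIdeal_mul, coeIdeal_pow, sq, mul_assoc]

theorem stdPoint_mem (i : Fin (squares K).index) (j : Fin (Nat.card (squares K))) :
    D.stdPoint i j ∈ M₁Class n (D.c i j) := by
  have hn := frac_ne_zero n
  have hq := frac_ne_zero (D.q j)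
  have hpq : frac (D.p i) * frac (D.q j) ≠ 0 := mul_ne_zero (frac_ne_zero _) hq
  rw [stdPoint_eq]
  refine ⟨⟨_, _, _, ⟨isOKLattice_oplus hpq hq, ?_, le_sup_left, ?_⟩,
    Submodule.mem_sup_right (Submodule.mem_span_singleton_self _), rfl, rfl⟩, ?_⟩
  · rw [oplus_sup_span, ← D.generates]
    exact isOKLattice_oplus hpq (mul_ne_zero hq (inv_ne_zero hn))
  · rw [nonempty_quotient_equiv_iff]
    intro r
    rw [integer_smul_vec, vec_mem_oplus, mul_zero,
      mul_mem_iff_of_generates hq (D.generates j) (coe_mem_one r)]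
    refine ⟨fun h => ?_, fun h => ⟨FractionalIdeal.zero_mem _, (mem_coeIdeal _).2 ⟨r, h, rfl⟩⟩⟩
    obtain ⟨s, hs, hsr⟩ := (mem_coeIdeal _).1 h.2
    rwa [← FaithfulSMul.algebraMap_injective (𝓞 K) K hsr]
  · rw [c_eq]
    change HasClass (oplus _ _) _
    rw [hasClass_oplus_iff hpq hq]
    exact ⟨1, one_ne_zero, by rw [spanSingleton_one, one_mul, frac_c]⟩

/-- Transitivity: `L` and `β` are brought simultaneously to standard form, and `L'` follows because
it is generated by them. -/
theorem exists_eq_act {i : Fin (squares K).index} {j : Fin (Nat.card (squares K))} {P : Triple K}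
    (hP : P ∈ M₁Class n (D.c i j)) : ∃ U : GG K, P = (D.stdPoint i j).act U := by
  obtain ⟨⟨L, L', β, ⟨hL, hL', hle, hquot⟩, hβ, rfl, rfl⟩, hc⟩ := hP
  change HasClass L _ at hc
  rw [nonempty_quotient_equiv_iff] at hquot
  have hq := frac_ne_zero (D.q j)
  have hpq : frac (D.p i) * frac (D.q j) ≠ 0 := mul_ne_zero (frac_ne_zero _) hq
  obtain ⟨A, B, U, hA, hB, rfl⟩ := hL.exists_eq_map_oplus
  rw [hasClass_map_iff, c_eq, hasClass_oplus_iff hA hB] at hc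
  obtain ⟨t, ht, htAB⟩ := hc
  -- Scaling makes the product of the ideals equal to `p_i q_j q_j` exactly, as a matrix of
  -- determinant one requires.
  obtain ⟨g₀, hg₀⟩ := exists_map_oplus_eq_smul (A := A) (B := B) ht
  rw [frac_c, ← mul_assoc] at htAB
  have hA' : spanSingleton (𝓞 K)⁰ t * A ≠ 0 := mul_ne_zero (spanSingleton_ne_zero_iff.2 ht) hA
  set A' := spanSingleton (𝓞 K)⁰ t * A with hA'def
  set V := U⁻¹ * toGG g₀ with hV
  have hL₀ : ((oplus A B).map (rightMul U)).map (rightMul V) = oplus A' B := by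
    rw [hV, map_rightMul_mul, ← map_rightMul_mul _ U, mul_inv_cancel, map_rightMul_one, hg₀]
  have hmem : ∀ v, v ∈ (oplus A B).map (rightMul U) ↔ rightMul V v ∈ oplus A' B := fun v => by
    rw [← hL₀]
    exact ((rightMul_injective V).mem_set_image
      (s := ((oplus A B).map (rightMul U) : Set (RowSpace K)))).symm
  -- A nonzero `r` in `n` carries `β` into `L`, so `β` also has coordinates in `K`.
  obtain ⟨x, y, hxy⟩ : ∃ x y : K, rightMul V β = vec x y := by
    obtain ⟨r, hr, hr0⟩ := Submodule.exists_mem_ne_zero_of_ne_bot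
      (nonZeroDivisors.coe_ne_zero n)
    have h1 := (hmem _).1 ((hquot r).2 hr)
    rw [map_smul] at h1
    obtain ⟨x, -, y, -, hxy⟩ := h1
    have hr0' : (r : K) ≠ 0 := by simpa using hr0
    refine ⟨(r : K)⁻¹ * x, (r : K)⁻¹ * y, ?_⟩
    rw [← smul_vec, ← show _ = vec x y from hxy, ← IsScalarTower.algebraMap_smul K r,
      inv_smul_smul₀ hr0']
  obtain ⟨g, hg, hgβ⟩ := exists_map_oplus_eq_and_vec hA' hB hpq hq htAB (D.generates j)
    (x := x) (y := y) (n := n) (fun r => by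
      rw [← hquot r, hmem, map_smul, hxy, integer_smul_vec, vec_mem_oplus])
  refine ⟨(V * toGG g)⁻¹, Triple.act_eq_iff.1 ?_⟩
  rw [stdPoint_eq, mkTriple_act, Submodule.map_sup, Submodule.map_span, Set.image_singleton,
    map_rightMul_mul, hL₀, hg, rightMul_mul, hxy, mkTriple_eq_iff]
  refine ⟨rfl, ?_, hgβ⟩
  set L₀ := oplus (frac (D.p i) * frac (D.q j)) (frac (D.q j))
  have key : ∀ {v w : RowSpace K}, v - w ∈ L₀ →
      L₀ ⊔ Submodule.span (𝓞 K) {v} ≤ L₀ ⊔ Submodule.span (𝓞 K) {w} := by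
    intro v w h
    refine sup_le le_sup_left ?_
    rw [Submodule.span_singleton_le_iff_mem]
    exact Submodule.mem_sup.2 ⟨_, h, w, Submodule.mem_span_singleton_self w, sub_add_cancel v w⟩
  exact le_antisymm (key hgβ) (key (by rw [← neg_sub]; exact L₀.neg_mem hgβ))

/-- Preserving the smaller lattice alone already forces the matrix into `GL(2, K)`. -/
theorem pair_act_eq_pair_iff (i : Fin (squares K).index) (j : Fin (Nat.card (squares K)))
    (W : GG K) : ((D.stdPoint i j).act W).pair = (D.stdPoint i j).pair ↔
      ∃ γ ∈ gamma₀ n (D.p i), W = toGG γ := by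
  have hq := frac_ne_zero (D.q j)
  have hpq : frac (D.p i) * frac (D.q j) ≠ 0 := mul_ne_zero (frac_ne_zero _) hq
  rw [Triple.pair_act, Prod.ext_iff]
  change (oplus _ _).map (rightMul W) = oplus _ _ ∧ (oplus _ _).map (rightMul W) = oplus _ _ ↔ _
  constructor
  · rintro ⟨h1, h2⟩
    obtain ⟨g, rfl⟩ := exists_eq_toGG hpq hq h1
    exact ⟨g, mem_gamma₀_iff.2 ⟨h1, h2⟩, rfl⟩
  · rintro ⟨γ, hγ, rfl⟩
    exact mem_gamma₀_iff.1 hγ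

/-- For `γ` in `gamma₀` the vector `(0, w)` moves by `(w γ 1 0, (γ 1 1 - 1) w)`. The first
coordinate is always in `p q`; the second is in `q` exactly when `γ 1 1 - 1` is in `n`. -/
theorem act_eq_self_iff (i : Fin (squares K).index) (j : Fin (Nat.card (squares K)))
    (W : GG K) : (D.stdPoint i j).act W = D.stdPoint i j ↔
      ∃ γ ∈ gamma₁ n (D.p i), W = toGG γ := by
  have hn := frac_ne_zero n
  have hq := frac_ne_zero (D.q j)
  have hpq : frac (D.p i) * frac (D.q j) ≠ 0 := mul_ne_zero (frac_ne_zero _) hq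
  have key : ∀ γ ∈ gamma₀ n (D.p i), (D.stdPoint i j).act (toGG γ) = D.stdPoint i j ↔
      γ ∈ gamma₁ n (D.p i) := by
    intro γ hγ
    set w := D.n₀ * (D.z j : K) with hw
    have hw' : (![0, algebraMap K (KHat K) w] : RowSpace K) = vec 0 w := by rw [vec, map_zero]
    have hwm : w ∈ frac (D.q j) * (frac n)⁻¹ := by
      rw [D.generates, ← spanSingleton_le_iff_mem]
      exact le_add_self
    obtain ⟨h1, h2⟩ := (mem_gamma₀_iff (q := D.q j)).1 hγ
    rw [stdPoint, mkTriple_act, mkTriple_eq_iff, h1, h2, ← hw, hw', rightMul_toGG_vec, vec_sub,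
      vec_mem_oplus]
    have e0 : 0 * γ 0 0 + w * γ 1 0 - 0 ∈ frac (D.p i) * frac (D.q j) := by
      have := mul_mem_mul hwm hγ.2.2.1
      rw [mul_assoc, inv_mul_cancel_left₀ hn, mul_comm (frac _)] at this
      simpa using this
    have e1 : 0 * γ 0 1 + w * γ 1 1 - w = (γ 1 1 - 1) * w := by ring
    have h11 : γ 1 1 - 1 ∈ (1 : FractionalIdeal (𝓞 K)⁰ K) :=
      sub_mem_fractionalIdeal hγ.2.2.2.1 (one_mem_one _)
    rw [e1, mul_mem_iff_of_generates hq (D.generates j) h11]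
    exact ⟨fun h => ⟨hγ, h.2.2.2⟩, fun h => ⟨rfl, rfl, e0, h.2⟩⟩
  constructor
  · intro h
    obtain ⟨γ, hγ, rfl⟩ := (D.pair_act_eq_pair_iff i j W).1 (congrArg Triple.pair h)
    exact ⟨γ, (key γ hγ).1 h, rfl⟩
  · rintro ⟨γ, hγ, rfl⟩
    exact (key γ hγ.1).2 hγ

/-- The coset modulo squares determines `i`, and the remaining square determines `j`. -/
theorem existsUnique_c (k : ClassGroup (𝓞 K)) :
    ∃! ij : Fin (squares K).index × Fin (Nat.card (squares K)), D.c ij.1 ij.2 = k := by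
  have mk_c : ∀ i j, (QuotientGroup.mk (D.c i j) : ClassGroup (𝓞 K) ⧸ squares K) =
      QuotientGroup.mk (ClassGroup.mk0 (D.p i)) := fun i j => by
    refine (QuotientGroup.eq.2 ?_).symm
    rw [c, inv_mul_cancel_left]
    exact ⟨ClassGroup.mk0 (D.q j), rfl⟩
  obtain ⟨i, hi⟩ := D.p_bijective.2 (QuotientGroup.mk k)
  obtain ⟨j, -, hj⟩ := D.q_bijOn.surjOn (QuotientGroup.eq.1 hi)
  have hk : D.c i j = k := by
    change _ * ClassGroup.mk0 (D.q j) ^ 2 = k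
    rw [show ClassGroup.mk0 (D.q j) ^ 2 = _ from hj, mul_inv_cancel_left]
  refine ⟨(i, j), hk, ?_⟩
  rintro ⟨i', j'⟩ h
  have h' : D.c i' j' = D.c i j := h.trans hk.symm
  have hii : i' = i := D.p_bijective.1 (by
    change QuotientGroup.mk _ = QuotientGroup.mk _
    rw [← mk_c i' j', ← mk_c i j, h'])
  subst hii
  rw [c, c, mul_right_inj] at h'
  exact Prod.ext rfl (D.q_bijOn.injOn (Set.mem_univ _) (Set.mem_univ _) h')

end Choices

theorem existsUnique_mem_M₁Class {P : Triple K} (hP : P ∈ M₁ n) :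
    ∃! ij : Fin (squares K).index × Fin (Nat.card (squares K)),
      P ∈ M₁Class n (D.c ij.1 ij.2) := by
  have hL : IsOKLattice P.pair.1 := by
    obtain ⟨L, L', β, h, -, -, rfl⟩ := hP
    exact h.lattice
  obtain ⟨k, hk, huniq⟩ := hL.existsUnique_hasClass
  obtain ⟨ij, hij, huniq'⟩ := D.existsUnique_c k
  exact ⟨ij, ⟨hP, hij.symm ▸ hk⟩, fun ij' h => huniq' ij' (huniq _ h.2)⟩

theorem isAdmissible_iff {i : Fin (squares K).index} {j : Fin (Nat.card (squares K))}
    {P : Triple K} (hP : P ∈ M₁Class n (D.c i j)) (U : GG K) :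
    D.IsAdmissible P U ↔ P = (D.stdPoint i j).act U := by
  constructor
  · rintro ⟨i', j', hP', h⟩
    have := (existsUnique_mem_M₁Class D hP.1).unique (y₁ := (i, j)) (y₂ := (i', j')) hP hP'
    obtain ⟨rfl, rfl⟩ := Prod.ext_iff.1 this
    exact h
  · exact fun h => ⟨i, j, hP, h⟩

theorem act_eq_act_iff (i : Fin (squares K).index) (j : Fin (Nat.card (squares K))) (U V : GG K) :
    (D.stdPoint i j).act U = (D.stdPoint i j).act V ↔
      ∃ γ ∈ gamma₁ n (D.p i), V = toGG γ * U := by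
  rw [eq_comm, ← inv_inv U, ← Triple.act_eq_iff, ← Triple.act_mul, D.act_eq_self_iff, inv_inv]
  simp only [mul_inv_eq_iff_eq_mul]

end StandardPoints

end ModularPoints

end

/-! ### Orbit-stabilizer. -/

open ModularPoints
theorem mainTheorem4 {K : Type*} [Field K] [NumberField K] (n : (Ideal (𝓞 K))⁰)
    (D : Choices n) :
    (∀ P ∈ M₁ n, ∃ U : GG K, D.IsAdmissible P U) ∧
    (∀ P ∈ M₁ n, ∃! ij : Fin (squares K).index × Fin (Nat.card (squares K)),
      P ∈ M₁Class n (D.c ij.1 ij.2)) ∧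
    (∀ (i : Fin (squares K).index) (j : Fin (Nat.card (squares K))),
      ∀ P ∈ M₁Class n (D.c i j), ∀ U : GG K, D.IsAdmissible P U →
      {V : GG K | D.IsAdmissible P V} = {V | ∃ γ ∈ gamma₁ n (D.p i), V = toGG γ * U} ∧
      {Q ∈ M₁ n | Q.pair = P.pair} =
        {Q | ∃ γ ∈ gamma₀ n (D.p i), Q = P.act (U⁻¹ * toGG γ * U)}) ∧
    (∀ (i : Fin (squares K).index) (j : Fin (Nat.card (squares K))),
      M₁Class n (D.c i j) = {P | ∃ U : GG K, P = (D.stdPoint i j).act U} ∧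
      ∃ f : Quotient (QuotientGroup.rightRel ((gamma₁ n (D.p i)).map toGG)) ≃
          M₁Class n (D.c i j),
        ∀ U : GG K, (f (Quotient.mk _ U) : Triple K) = (D.stdPoint i j).act U) := by
  refine ⟨fun P hP => ?_, fun P hP => existsUnique_mem_M₁Class D hP, fun i j P hP U hU => ?_,
    fun i j => ⟨Set.ext fun P => ⟨D.exists_eq_act, ?_⟩, ?_⟩⟩
  · obtain ⟨⟨i, j⟩, hij, -⟩ := existsUnique_mem_M₁Class D hP
    obtain ⟨U, hU⟩ := D.exists_eq_act hij
    exact ⟨U, i, j, hij, hU⟩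
  · rw [isAdmissible_iff D hP] at hU
    constructor
    · ext V
      rw [Set.mem_ofPred_eq, Set.mem_ofPred_eq, isAdmissible_iff D hP, hU, act_eq_act_iff]
    · ext Q
      rw [Set.mem_ofPred_eq, Set.mem_ofPred_eq]
      -- Conjugation by `U` transfers the question to the standard point.
      have hact : ∀ γ : GL (Fin 2) K,
          P.act (U⁻¹ * toGG γ * U) = ((D.stdPoint i j).act (toGG γ)).act U := fun γ => by
        rw [hU, ← Triple.act_mul, ← Triple.act_mul, mul_assoc, mul_inv_cancel_left]
      constructor
      · rintro ⟨hQ, hpair⟩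
        -- The class depends only on `L`, so `Q` lies in the same orbit as `P`.
        have hQ' : Q ∈ M₁Class n (D.c i j) := ⟨hQ, hpair ▸ hP.2⟩
        obtain ⟨V, rfl⟩ := D.exists_eq_act hQ'
        have h : ((D.stdPoint i j).act (V * U⁻¹)).pair = (D.stdPoint i j).pair := by
          rw [Triple.act_mul, Triple.pair_act, hpair, hU, ← Triple.pair_act, ← Triple.act_mul,
            mul_inv_cancel, Triple.act_one]
        obtain ⟨γ, hγ, hVU⟩ := (D.pair_act_eq_pair_iff i j _).1 h
        refine ⟨γ, hγ, ?_⟩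
        rw [hact, ← hVU, ← Triple.act_mul, inv_mul_cancel_right]
      · rintro ⟨γ, hγ, rfl⟩
        refine ⟨act_mem_M₁ hP.1 _, ?_⟩
        rw [hact, hU, Triple.pair_act, (D.pair_act_eq_pair_iff i j _).2 ⟨γ, hγ, rfl⟩,
          ← Triple.pair_act]
  · rintro ⟨U, rfl⟩
    exact act_mem_M₁Class (D.stdPoint_mem i j) U
  -- The right cosets are the fibres of the orbit map of the standard point.
  · have hrel : ∀ U V : GG K, (QuotientGroup.rightRel ((gamma₁ n (D.p i)).map toGG)) U V ↔
        (D.stdPoint i j).act U = (D.stdPoint i j).act V := fun U V => by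
      rw [QuotientGroup.rightRel_apply, act_eq_act_iff]
      exact exists_congr fun γ => and_congr_right fun _ =>
        eq_mul_inv_iff_mul_eq.trans eq_comm
    refine ⟨Equiv.ofBijective (Quotient.lift (fun U => (⟨(D.stdPoint i j).act U,
      act_mem_M₁Class (D.stdPoint_mem i j) U⟩ : M₁Class n (D.c i j)))
      fun U V h => Subtype.ext ((hrel U V).1 h)) ⟨?_, ?_⟩, fun _ => rfl⟩
    · intro x y
      induction x, y using Quotient.inductionOn₂ with
      | h U V => exact fun h => Quotient.sound ((hrel U V).2 (congrArg Subtype.val h))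
    · rintro ⟨P, hP⟩
      obtain ⟨U, rfl⟩ := D.exists_eq_act hP
      exact ⟨Quotient.mk _ U, rfl⟩
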